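/- Let $(M^{n+1},g)$ be a smooth oriented semi-Riemannian spin manifold with a fixed spin structure, with spinor bundle $S_M$, Levi-Civita connection $\nabla^M$ and Clifford multiplication normalized by $X\cdot X\cdot\varphi=-g(X,X)\varphi$; spinor bundles are associated with irreducible complex modules of the Clifford algebra, and carry the spinor derivative $\nabla^{S}$ induced by the Levi-Civita connection. On a semi-Riemannian spin manifold $(N^d,h)$ with spinor bundle $S$, the Dirac operator is $D\varphi=\sum_{j}\varepsilon_j s_j\cdot\nabla^S_{s_j}\varphi$, and a smooth section $\varphi$ of $S$ is called a twistor spinor if it lies in the kernel of the twistor operator $$\mathcal D\varphi=\sum_{j=1}^{d}\varepsilon_j\, s_j\otimes\Bigl(\nabla^S_{s_j}\varphi+\tfrac1d\, s_j\cdot D\varphi\Bigr),$$ where $(s_1,\dots,s_d)$ is a local orthonormal frame and $\varepsilon_j=h(s_j,s_j)=\pm1$. Let $F^n\subset M^{n+1}$ be a (possibly immersed) nondegenerate oriented hypersurface with the induced metric $g|_F$ and with smooth unit normal field $\eta$, $g(\eta,\eta)=\kappa=\pm1$, and let $F$ carry the spin structure induced from $M$, i.e. the reduction of the spin structure of $M$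 along $F$ to the frames of the form $(\eta,s_1,\dots,s_n)$ with $(s_1,\dots,s_n)$ an orthonormal frame of $F$ (the position of $\eta$ among the frame vectors may be any fixed one), with spinor bundle $S_F$. Let $\varphi\mapsto\varphi|_F$ denote the restriction of spinor fields of $M$ to $F$ followed by the bundle map $r:S_M|_F\to S_F$ induced by a complex linear map of the spinor modules which commutes with the Clifford multiplication by the vectors tangent to $F$, so that $X\cdot(\varphi|_F)=(X\cdot\varphi)|_F$ for $X\in TF$, and which is an isomorphism $S_M|_F\cong S_F$ if $n$ is even and restricts to isomorphisms $S_M^{\pm}|_F\cong S_F$ of the half-spinor bundles if $n$ is odd. Suppose that $F$ is umbilic, that is, $\nabla^M_X\eta=\lambda X$ for all $X\in TF$ with a function $\lambda\in C^\infty(F)$. If $\varphi\in\Gamma(S_M)$ is a twistor spinor on $M$ (in particular, for $n$ odd, if $\varphi\in\Gamma(S_M^{\pm})$ is one), then $\varphi|_F\in\Gamma(S_F)$ is a twistor spinor on $F$. -/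

import Mathlib

open scoped Manifold ContDiff Topology TensorProduct
open Bundle VectorField

noncomputable section

namespace SpinGeometry

/-! ## Semi-Riemannian metrics and the Levi-Civita connection -/

section LeviCivita

variable {E : Type*} [NormedAddCommGroup E] [NormedSpace ℝ E]
  {H : Type*} [TopologicalSpace H] {I : ModelWithCorners ℝ E H}
  {M : Type*} [TopologicalSpace M] [ChartedSpace H M] [IsManifold I ∞ M]

/-- A smooth semi-Riemannian metric on `M`: a smooth field of nondegenerate symmetric bilinear forms
on the tangent spaces. -/
structure SemiRiemannianMetric {E : Type*} [NormedAddCommGroup E] [NormedSpace ℝ E]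
    {H : Type*} [TopologicalSpace H] (I : ModelWithCorners ℝ E H)
    (M : Type*) [TopologicalSpace M] [ChartedSpace H M] [IsManifold I ∞ M] where
  inner (x : M) : TangentSpace I x →L[ℝ] TangentSpace I x →L[ℝ] ℝ
  symm (x : M) (v w : TangentSpace I x) : inner x v w = inner x w v
  nondegenerate (x : M) (v : TangentSpace I x) (hv : ∀ w, inner x v w = 0) : v = 0
  contMDiff : ContMDiff I (I.prod 𝓘(ℝ, E →L[ℝ] E →L[ℝ] ℝ)) ∞
    (fun x => TotalSpace.mk' (E →L[ℝ] E →L[ℝ] ℝ) x (inner x))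

namespace SemiRiemannianMetric

variable (g : SemiRiemannianMetric I M)

lemma mdifferentiableAt_inner {X Y : Π x : M, TangentSpace I x} {x : M}
    (hX : MDiffAt (T% X) x) (hY : MDiffAt (T% Y) x) :
    MDiffAt (fun y => g.inner y (X y) (Y y)) x := by
  have hg := (g.contMDiff x).mdifferentiableAt (by simp)
  have : MDifferentiableAt I (I.prod 𝓘(ℝ))
      (fun m ↦ TotalSpace.mk' ℝ (E := Bundle.Trivial M ℝ) m (g.inner m (X m) (Y m))) x := by
    apply MDifferentiableAt.clm_bundle_apply₂ (F₁ := E) (F₂ := E)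
    · exact hg
    · exact hX
    · exact hY
  simp only [← mdifferentiableWithinAt_univ, mdifferentiableWithinAt_totalSpace] at this ⊢
  exact this.2

/-- Right-hand side of the Koszul formula: the value at `x` of `g(∇_X Y, Z)`. -/
def koszul (X Y Z : Π x : M, TangentSpace I x) (x : M) : ℝ :=
  (1 / 2) * (d% (fun y => g.inner y (Y y) (Z y)) x (X x)
    + d% (fun y => g.inner y (X y) (Z y)) x (Y x)
    - d% (fun y => g.inner y (X y) (Y y)) x (Z x)
    + g.inner x (mlieBracket I X Y x) (Z x)
    - g.inner x (mlieBracket I X Z x) (Y x)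
    - g.inner x (mlieBracket I Y Z x) (X x))

lemma mvfderiv_inner_smul {f : M → ℝ} {X Y : Π x : M, TangentSpace I x} {x : M}
    (hf : MDiffAt f x) (hX : MDiffAt (T% X) x) (hY : MDiffAt (T% Y) x) (v : TangentSpace I x) :
    d% (fun y => g.inner y ((f • X) y) (Y y)) x v
      = f x * d% (fun y => g.inner y (X y) (Y y)) x v + g.inner x (X x) (Y x) * d% f x v := by
  have := mvfderiv_fun_mul hf (g.mdifferentiableAt_inner hX hY)
  simp [this]

lemma mvfderiv_inner_smul' {f : M → ℝ} {X Y : Π x : M, TangentSpace I x} {x : M}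
    (hf : MDiffAt f x) (hX : MDiffAt (T% X) x) (hY : MDiffAt (T% Y) x) (v : TangentSpace I x) :
    d% (fun y => g.inner y (X y) ((f • Y) y)) x v
      = f x * d% (fun y => g.inner y (X y) (Y y)) x v + g.inner x (X x) (Y x) * d% f x v := by
  have := mvfderiv_fun_mul hf (g.mdifferentiableAt_inner hX hY)
  simp [this]

lemma mvfderiv_inner_add {X X' Y : Π x : M, TangentSpace I x} {x : M}
    (hX : MDiffAt (T% X) x) (hX' : MDiffAt (T% X') x) (hY : MDiffAt (T% Y) x)
    (v : TangentSpace I x) :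
    d% (fun y => g.inner y ((X + X') y) (Y y)) x v
      = d% (fun y => g.inner y (X y) (Y y)) x v + d% (fun y => g.inner y (X' y) (Y y)) x v := by
  have := mvfderiv_fun_add (g.mdifferentiableAt_inner hX hY) (g.mdifferentiableAt_inner hX' hY)
  simp [this]

lemma mvfderiv_inner_add' {X Y Y' : Π x : M, TangentSpace I x} {x : M}
    (hX : MDiffAt (T% X) x) (hY : MDiffAt (T% Y) x) (hY' : MDiffAt (T% Y') x)
    (v : TangentSpace I x) :
    d% (fun y => g.inner y (X y) ((Y + Y') y)) x v
      = d% (fun y => g.inner y (X y) (Y y)) x v + d% (fun y => g.inner y (X y) (Y' y)) x v := by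
  have := mvfderiv_fun_add (g.mdifferentiableAt_inner hX hY) (g.mdifferentiableAt_inner hX hY')
  simp [this]

lemma ext_inner {x : M} {v w : TangentSpace I x} (h : ∀ z, g.inner x v z = g.inner x w z) :
    v = w :=
  sub_eq_zero.1 (g.nondegenerate x _ fun z => by simp [h z])

lemma exists_extension {x : M} (v : TangentSpace I x) :
    ∃ X : Π x : M, TangentSpace I x, MDiffAt (T% X) x ∧ X x = v :=
  ⟨FiberBundle.extend E v, FiberBundle.mdifferentiableAt_extend .., by simp⟩

variable [FiniteDimensional ℝ E]

lemma koszul_tensorial_left {Y Z : Π x : M, TangentSpace I x} {x : M}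
    (hY : MDiffAt (T% Y) x) (hZ : MDiffAt (T% Z) x) :
    TensorialAt I E (fun X => g.koszul X Y Z x) x where
  smul {f X} hf hX := by
    have hc : CompleteSpace E := FiniteDimensional.complete ℝ E
    simp only [koszul, g.mvfderiv_inner_smul hf hX hZ, g.mvfderiv_inner_smul hf hX hY,
      mlieBracket_smul_left hf hX]
    simp
    ring
  add {X X'} hX hX' := by
    have hc : CompleteSpace E := FiniteDimensional.complete ℝ E
    simp only [koszul, g.mvfderiv_inner_add hX hX' hZ, g.mvfderiv_inner_add hX hX' hY,
      mlieBracket_add_left hX hX']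
    simp
    ring

lemma koszul_tensorial_right {X Y : Π x : M, TangentSpace I x} {x : M}
    (hX : MDiffAt (T% X) x) (hY : MDiffAt (T% Y) x) :
    TensorialAt I E (fun Z => g.koszul X Y Z x) x where
  smul {f Z} hf hZ := by
    have hc : CompleteSpace E := FiniteDimensional.complete ℝ E
    simp only [koszul, g.mvfderiv_inner_smul' hf hY hZ, g.mvfderiv_inner_smul' hf hX hZ,
      mlieBracket_smul_right hf hZ]
    simp [g.symm x (Z x)]
    ring
  add {Z Z'} hZ hZ' := by
    have hc : CompleteSpace E := FiniteDimensional.complete ℝ E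
    simp only [koszul, g.mvfderiv_inner_add' hX hZ hZ', g.mvfderiv_inner_add' hY hZ hZ',
      mlieBracket_add_right hZ hZ']
    simp
    ring

open Classical in
/-- The bilinear form `(v, w) ↦ g(∇_v Y, w)` on the tangent space at `x`, for a vector field `Y`
which is differentiable at `x`. -/
def koszulForm (Y : Π x : M, TangentSpace I x) (x : M) :
    TangentSpace I x →L[ℝ] TangentSpace I x →L[ℝ] ℝ :=
  if hY : MDiffAt (T% Y) x then
    TensorialAt.mkHom₂ (fun X Z => g.koszul X Y Z x) x
      (fun _ hZ => g.koszul_tensorial_left hY hZ) (fun _ hX => g.koszul_tensorial_right hX hY)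
  else 0

lemma koszulForm_apply {X Y Z : Π x : M, TangentSpace I x} {x : M}
    (hX : MDiffAt (T% X) x) (hY : MDiffAt (T% Y) x) (hZ : MDiffAt (T% Z) x) :
    g.koszulForm Y x (X x) (Z x) = g.koszul X Y Z x := by
  rw [koszulForm, dif_pos hY]
  exact TensorialAt.mkHom₂_apply (Φ := fun X Z => g.koszul X Y Z x)
    (fun _ hZ => g.koszul_tensorial_left hY hZ) (fun _ hX => g.koszul_tensorial_right hX hY) hX hZ

/-- The musical isomorphism `v ↦ g(v, ·)`. -/
def flat (x : M) : TangentSpace I x ≃ₗ[ℝ] Module.Dual ℝ (TangentSpace I x) :=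
  haveI : FiniteDimensional ℝ (TangentSpace I x) := inferInstanceAs (FiniteDimensional ℝ E)
  LinearMap.linearEquivOfInjective
    (LinearMap.mk₂ ℝ (fun v w => g.inner x v w) (by simp) (by simp) (by simp) (by simp))
    ((injective_iff_map_eq_zero _).2 fun v hv =>
      g.nondegenerate x v fun w => by simpa using congrArg (fun l => l w) hv)
    Subspace.dual_finrank_eq.symm

lemma flat_apply (x : M) (v w : TangentSpace I x) : g.flat x v w = g.inner x v w := rfl

/-- The covariant derivative `v ↦ ∇_v Y` at `x` of the Levi-Civita connection, as a function of the
vector field `Y`: the solution of the Koszul formula. -/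
def leviCivitaFun (Y : Π x : M, TangentSpace I x) (x : M) :
    TangentSpace I x →L[ℝ] TangentSpace I x :=
  haveI : FiniteDimensional ℝ (TangentSpace I x) := inferInstanceAs (FiniteDimensional ℝ E)
  haveI : T2Space (TangentSpace I x) := inferInstanceAs (T2Space E)
  LinearMap.toContinuousLinearMap
    ((g.flat x).symm.toLinearMap ∘ₗ
      LinearMap.mk₂ ℝ (fun v w => g.koszulForm Y x v w) (by simp) (by simp) (by simp) (by simp))

lemma inner_leviCivitaFun (Y : Π x : M, TangentSpace I x) (x : M) (v w : TangentSpace I x) :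
    g.inner x (g.leviCivitaFun Y x v) w = g.koszulForm Y x v w := by
  rw [← flat_apply]
  simp [leviCivitaFun]

lemma inner_leviCivitaFun_eq_koszul {X Y Z : Π x : M, TangentSpace I x} {x : M}
    (hX : MDiffAt (T% X) x) (hY : MDiffAt (T% Y) x) (hZ : MDiffAt (T% Z) x) :
    g.inner x (g.leviCivitaFun Y x (X x)) (Z x) = g.koszul X Y Z x := by
  rw [inner_leviCivitaFun, g.koszulForm_apply hX hY hZ]

/-- The Levi-Civita connection of a semi-Riemannian metric. -/
def leviCivita : CovariantDerivative I E (TangentSpace I : M → Type _) where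
  toFun := g.leviCivitaFun
  isCovariantDerivativeOnUniv :=
    { add := by
        intro Y Y' x hY hY' _
        have hc : CompleteSpace E := FiniteDimensional.complete ℝ E
        ext v
        refine g.ext_inner fun w => ?_
        obtain ⟨X, hX, rfl⟩ := exists_extension v
        obtain ⟨Z, hZ, rfl⟩ := exists_extension w
        rw [add_apply, map_add, add_apply,
          g.inner_leviCivitaFun_eq_koszul hX hY hZ, g.inner_leviCivitaFun_eq_koszul hX hY' hZ,
          g.inner_leviCivitaFun_eq_koszul hX (mdifferentiableAt_add_section hY hY') hZ]
        simp only [koszul, g.mvfderiv_inner_add hY hY' hZ, g.mvfderiv_inner_add' hX hY hY',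
          mlieBracket_add_left hY hY', mlieBracket_add_right hY hY']
        simp
        ring
      leibniz := by
        intro Y f x hY hf _
        have hc : CompleteSpace E := FiniteDimensional.complete ℝ E
        ext v
        refine g.ext_inner fun w => ?_
        obtain ⟨X, hX, rfl⟩ := exists_extension v
        obtain ⟨Z, hZ, rfl⟩ := exists_extension w
        rw [add_apply, map_add, add_apply, smul_apply, map_smul, smul_apply,
          g.inner_leviCivitaFun_eq_koszul hX hY hZ,
          g.inner_leviCivitaFun_eq_koszul hX (hf.smul_section hY) hZ]
        simp only [koszul, g.mvfderiv_inner_smul hf hY hZ, g.mvfderiv_inner_smul' hf hX hY,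
          mlieBracket_smul_left hf hY, mlieBracket_smul_right hf hY]
        simp [g.symm x (Y x)]
        ring }

lemma inner_leviCivita {X Y Z : Π x : M, TangentSpace I x} {x : M}
    (hX : MDiffAt (T% X) x) (hY : MDiffAt (T% Y) x) (hZ : MDiffAt (T% Z) x) :
    g.inner x (g.leviCivita Y x (X x)) (Z x) = g.koszul X Y Z x :=
  g.inner_leviCivitaFun_eq_koszul hX hY hZ

/-- The Levi-Civita connection is torsion-free. -/
lemma leviCivita_torsion {X Y : Π x : M, TangentSpace I x} {x : M}
    (hX : MDiffAt (T% X) x) (hY : MDiffAt (T% Y) x) :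
    g.leviCivita Y x (X x) - g.leviCivita X x (Y x) = mlieBracket I X Y x := by
  refine g.ext_inner fun w => ?_
  obtain ⟨Z, hZ, rfl⟩ := exists_extension w
  rw [map_sub, sub_apply, g.inner_leviCivita hX hY hZ, g.inner_leviCivita hY hX hZ]
  have h1 : mlieBracket I Y X x = - mlieBracket I X Y x := mlieBracket_swap_apply
  have h2 : (fun y => g.inner y (Y y) (X y)) = fun y => g.inner y (X y) (Y y) :=
    funext fun y => g.symm y _ _
  simp only [koszul, h1, h2]
  simp
  ring

/-- The Levi-Civita connection is metric. -/
lemma leviCivita_metric {X Y Z : Π x : M, TangentSpace I x} {x : M}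
    (hX : MDiffAt (T% X) x) (hY : MDiffAt (T% Y) x) (hZ : MDiffAt (T% Z) x) :
    d% (fun y => g.inner y (Y y) (Z y)) x (X x)
      = g.inner x (g.leviCivita Y x (X x)) (Z x) + g.inner x (Y x) (g.leviCivita Z x (X x)) := by
  rw [g.symm x (Y x), g.inner_leviCivita hX hY hZ, g.inner_leviCivita hX hZ hY]
  have h1 : mlieBracket I Z Y x = - mlieBracket I Y Z x := mlieBracket_swap_apply
  have h2 : (fun y => g.inner y (Z y) (Y y)) = fun y => g.inner y (Y y) (Z y) :=
    funext fun y => g.symm y _ _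
  simp only [koszul, h1, h2]
  simp
  ring

end SemiRiemannianMetric
end LeviCivita
/-! ## Clifford algebras, spin groups and spinor modules -/

section Clifford

variable {d : ℕ}

/-- The quadratic form `v ↦ -⟨v, v⟩`, where `⟨v, w⟩ = ∑ i, ε i * v i * w i` is the scalar product on
`ℝ^d` whose canonical basis is orthonormal with the signs `ε i = ±1`. -/
def cliffordForm (ε : Fin d → ℤˣ) : QuadraticForm ℝ (Fin d → ℝ) :=
  QuadraticMap.weightedSumSquares ℝ (fun i => -((ε i : ℤ) : ℝ))

/-- The Clifford algebra of `(ℝ^d, -⟨·, ·⟩)`, so that `e_i e_j + e_j e_i = -2 ε_i δ_ij`. -/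
abbrev Cliff (ε : Fin d → ℤˣ) : Type := CliffordAlgebra (cliffordForm ε)

/-- The inclusion of the vectors into the Clifford algebra. -/
abbrev vec (ε : Fin d → ℤˣ) : (Fin d → ℝ) →ₗ[ℝ] Cliff ε := CliffordAlgebra.ι (cliffordForm ε)

/-- The image in the Clifford algebra of the canonical basis of `ℝ^d`. -/
def basisVec (ε : Fin d → ℤˣ) (i : Fin d) : Cliff ε := vec ε (Pi.single i 1)

/-- The spin group: the products of an even number of vectors `v` with `⟨v, v⟩ = ±1`. It acts on
`ℝ^d` by `λ(u) v = u v u⁻¹`, which is the two-fold covering of the special orthogonal group. -/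
def spin (ε : Fin d → ℤˣ) : Subgroup (Cliff ε)ˣ :=
  Subgroup.closure {u | ∃ v w : Fin d → ℝ,
    (cliffordForm ε v = 1 ∨ cliffordForm ε v = -1) ∧
    (cliffordForm ε w = 1 ∨ cliffordForm ε w = -1) ∧ (u : Cliff ε) = vec ε v * vec ε w}

/-- A complex spinor module: an irreducible complex representation of the Clifford algebra. Its
restriction to the spin group is the spinor representation. -/
structure SpinorModule (ε : Fin d → ℤˣ) (Δ : Type*) [AddCommGroup Δ] [Module ℂ Δ] where
  /-- The action of the Clifford algebra. -/
  act : Cliff ε →ₐ[ℝ] Module.End ℂ Δ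
  nontrivial : Nontrivial Δ
  irreducible (W : Submodule ℂ Δ) (hW : ∀ a, ∀ w ∈ W, act a w ∈ W) : W = ⊥ ∨ W = ⊤

/-- The volume element `e_1 ⋯ e_d`. -/
def volumeElement (ε : Fin d → ℤˣ) : Cliff ε := (List.ofFn (basisVec ε)).prod

/-- For `d = 2 m` even and `k` the number of negative signs, the half spinor spaces `Δ⁺` and `Δ⁻`:
the eigenspaces of the volume element to the eigenvalues `± i ^ (m + k)`. -/
def halfSpinors {ε : Fin d → ℤˣ} {Δ : Type*} [AddCommGroup Δ] [Module ℂ Δ]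
    (ρ : SpinorModule ε Δ) (δ : ℤˣ) : Set Δ :=
  {w | ρ.act (volumeElement ε) w =
    (((δ : ℤ) : ℂ) * Complex.I ^ (d / 2 + (Finset.univ.filter (fun i => ε i = -1)).card)) • w}

/-- The inclusion of `ℝ^n` into `ℝ^(n+1)` as the hyperplane on which the coordinate `p` vanishes. -/
def hyperplane {n : ℕ} (ε : Fin (n + 1) → ℤˣ) (p : Fin (n + 1)) :
    cliffordForm (fun i => ε (p.succAbove i)) →qᵢ cliffordForm ε where
  toFun v := p.insertNth (α := fun _ => ℝ) 0 v
  map_add' v w := by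
    ext i
    refine Fin.succAboveCases p ?_ (fun j => ?_) i <;> simp
  map_smul' c v := by
    ext i
    refine Fin.succAboveCases p ?_ (fun j => ?_) i <;> simp
  map_app' v := by
    simp [cliffordForm, QuadraticMap.weightedSumSquares_apply, Fin.sum_univ_succAbove _ p]

/-- An identification of the spinor modules of a Euclidean-type space `ℝ^(n+1)` and its hyperplane
`ℝ^n` (orthogonal to the basis vector with index `p`): a complex linear map which commutes with the
Clifford multiplication by the vectors of the hyperplane, and which is an isomorphism `Δ_M ≅ Δ_F`
for `n` even, and restricts to isomorphisms `Δ_M^± ≅ Δ_F` for `n` odd. -/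
structure SpinorIdentification {n : ℕ} {ε : Fin (n + 1) → ℤˣ} (p : Fin (n + 1))
    {ΔM ΔF : Type*} [AddCommGroup ΔM] [Module ℂ ΔM] [AddCommGroup ΔF] [Module ℂ ΔF]
    (ρM : SpinorModule ε ΔM) (ρF : SpinorModule (fun i => ε (p.succAbove i)) ΔF) where
  /-- The underlying linear map. -/
  toLin : ΔM →ₗ[ℂ] ΔF
  map_vec (v : Fin n → ℝ) (w : ΔM) :
    toLin (ρM.act (vec ε (hyperplane ε p v)) w) = ρF.act (vec _ v) (toLin w)
  bijective_of_even (hn : Even n) : Function.Bijective toLin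
  bijOn_of_odd (hn : Odd n) (δ : ℤˣ) : Set.BijOn toLin (halfSpinors ρM δ) Set.univ

end Clifford

/-! ## Spin structures and spinor fields -/

section Spin

variable {d : ℕ} {M : Type*} [TopologicalSpace M] [ChartedSpace (EuclideanSpace ℝ (Fin d)) M]
  [IsManifold (𝓡 d) ∞ M]

/-- The coordinates of a tangent vector `w` with respect to a basis `e` of the tangent space which
is orthonormal with the signs `ε`. -/
def coords (g : SemiRiemannianMetric (𝓡 d) M) (ε : Fin d → ℤˣ) {x : M}
    (e : Fin d → TangentSpace (𝓡 d) x) (w : TangentSpace (𝓡 d) x) : Fin d → ℝ :=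
  fun i => ((ε i : ℤ) : ℝ) * g.inner x w (e i)

/-- Smoothness of a map from a manifold into the (finite-dimensional) Clifford algebra: all linear
functionals of it are smooth. -/
def CliffSmoothOn (d : ℕ) {M : Type*} [TopologicalSpace M]
    [ChartedSpace (EuclideanSpace ℝ (Fin d)) M] {m : ℕ} {ε : Fin m → ℤˣ}
    (f : M → Cliff ε) (s : Set M) : Prop :=
  ∀ l : Cliff ε →ₗ[ℝ] ℝ, ContMDiffOn (𝓡 d) 𝓘(ℝ, ℝ) ∞ (fun x => l (f x)) s

/-- A spin structure on the semi-Riemannian manifold `(M, g)`, given by a smooth cocycle: an open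
cover by domains of smooth local orthonormal frames (with the signs `ε`), together with lifts to the
spin group of the changes of frame which satisfy the cocycle condition. The principal spin bundle is
glued from the products of the domains and the spin group; since the changes of frame lie in the
special orthogonal group, the frames determine the orientation of `M`. -/
structure SpinStructure (A : Type*) (g : SemiRiemannianMetric (𝓡 d) M) (ε : Fin d → ℤˣ) where
  /-- The domains of the local frames. -/
  dom : A → Set M
  isOpen_dom (a : A) : IsOpen (dom a)
  exists_mem_dom (x : M) : ∃ a, x ∈ dom a
  /-- The local orthonormal frames. -/
  frame : A → Fin d → Π x : M, TangentSpace (𝓡 d) x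
  frame_smooth (a : A) (i : Fin d) : ContMDiffOn (𝓡 d) (𝓡 d).tangent ∞
    (fun x => (⟨x, frame a i x⟩ : TangentBundle (𝓡 d) M)) (dom a)
  frame_orthonormal {a : A} {x : M} (hx : x ∈ dom a) (i j : Fin d) :
    g.inner x (frame a i x) (frame a j x) = if i = j then ((ε i : ℤ) : ℝ) else 0
  /-- The lifts of the changes of frame. -/
  trans : A → A → M → (Cliff ε)ˣ
  trans_mem {a b : A} {x : M} (ha : x ∈ dom a) (hb : x ∈ dom b) : trans a b x ∈ spin ε
  trans_smooth (a b : A) :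
    CliffSmoothOn d (fun x => (trans a b x : Cliff ε)) (dom a ∩ dom b)
  /-- `λ(trans a b x)` maps the coordinates in the frame `b` to the coordinates in the frame `a`. -/
  trans_frame {a b : A} {x : M} (ha : x ∈ dom a) (hb : x ∈ dom b) (w : TangentSpace (𝓡 d) x) :
    (trans a b x : Cliff ε) * vec ε (coords g ε (fun i => frame b i x) w)
      = vec ε (coords g ε (fun i => frame a i x) w) * trans a b x
  trans_cocycle {a b c : A} {x : M} (ha : x ∈ dom a) (hb : x ∈ dom b) (hc : x ∈ dom c) :
    trans a b x * trans b c x = trans a c x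

variable {A : Type*} {g : SemiRiemannianMetric (𝓡 d) M} {ε : Fin d → ℤˣ}
  (σ : SpinStructure A g ε)
  {Δ : Type*} [NormedAddCommGroup Δ] [NormedSpace ℂ Δ] (ρ : SpinorModule ε Δ)

/-- A smooth section of the spinor bundle associated with the spin structure by the spinor
representation: smooth functions `φ a : dom a → Δ`, related by the action of the cocycle. (The
values of `φ a` outside of `dom a` are irrelevant.) -/
structure IsSpinorField (φ : A → M → Δ) : Prop where
  smooth (a : A) : ContMDiffOn (𝓡 d) 𝓘(ℝ, Δ) ∞ (φ a) (σ.dom a)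
  compat {a b : A} {x : M} (ha : x ∈ σ.dom a) (hb : x ∈ σ.dom b) :
    φ a x = ρ.act (σ.trans a b x : Cliff ε) (φ b x)

/-- The Clifford multiplication of a spinor (in the gauge `a`) by the tangent vector `v` at `x`. -/
def cliffMul (a : A) {x : M} (v : TangentSpace (𝓡 d) x) (w : Δ) : Δ :=
  ρ.act (vec ε (coords g ε (fun i => σ.frame a i x) v)) w

/-- The spinor derivative induced by the Levi-Civita connection, in the gauge `a` with the frame
`s = σ.frame a`:
`∇_v φ = v(φ) + 1/2 ∑_{k < l} ε_k ε_l g(∇_v s_k, s_l) e_k e_l φ`. -/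
def spinorDeriv (φ : A → M → Δ) (a : A) {x : M} (v : TangentSpace (𝓡 d) x) : Δ :=
  mvfderiv (𝓡 d) (φ a) x v +
    (1 / 2 : ℝ) • ∑ k, ∑ l ∈ Finset.univ.filter (fun l => k < l),
      (((ε k : ℤ) : ℝ) * ((ε l : ℤ) : ℝ)
          * g.inner x (g.leviCivita (σ.frame a k) x v) (σ.frame a l x)) •
        ρ.act (basisVec ε k * basisVec ε l) (φ a x)

/-- The Dirac operator `D φ = ∑ j, ε_j s_j · ∇_{s_j} φ`, in the gauge `a`. -/
def dirac (φ : A → M → Δ) (a : A) (x : M) : Δ :=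
  ∑ j, ((ε j : ℤ) : ℝ) •
    cliffMul σ ρ a (σ.frame a j x) (spinorDeriv σ ρ φ a (σ.frame a j x))

/-- The twistor operator `∑ j, ε_j s_j ⊗ (∇_{s_j} φ + (1 / d) s_j · D φ)`, in the gauge `a`: the
projection of `∇ φ` to the kernel of the Clifford multiplication `TM ⊗ S → S`. -/
def twistorOperator (φ : A → M → Δ) (a : A) (x : M) : TangentSpace (𝓡 d) x ⊗[ℝ] Δ :=
  ∑ j, ((ε j : ℤ) : ℝ) • (σ.frame a j x ⊗ₜ[ℝ]
    (spinorDeriv σ ρ φ a (σ.frame a j x)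
      + (1 / (d : ℝ)) • cliffMul σ ρ a (σ.frame a j x) (dirac σ ρ φ a x)))

/-- A twistor spinor: a smooth spinor field in the kernel of the twistor operator. -/
def IsTwistorSpinor (φ : A → M → Δ) : Prop :=
  IsSpinorField σ ρ φ ∧ ∀ a, ∀ x ∈ σ.dom a, twistorOperator σ ρ φ a x = 0

end Spin

/-! ## Hypersurfaces -/

section Hypersurface

variable {n : ℕ} {M F : Type*}
  [TopologicalSpace M] [ChartedSpace (EuclideanSpace ℝ (Fin (n + 1))) M]
  [IsManifold (𝓡 (n + 1)) ∞ M]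
  [TopologicalSpace F] [ChartedSpace (EuclideanSpace ℝ (Fin n)) F] [IsManifold (𝓡 n) ∞ F]

/-- A nondegenerate oriented hypersurface `F → M`: a smooth map under which the metric `gF` of `F`
is the metric induced by `gM` (in particular, it is an immersion, and the induced metric is
nondegenerate), together with a smooth unit normal field `η` (the Gauss map), `g(η, η) = κ = ±1`. -/
structure OrientedHypersurface (gM : SemiRiemannianMetric (𝓡 (n + 1)) M)
    (gF : SemiRiemannianMetric (𝓡 n) F) (κ : ℤˣ) where
  /-- The inclusion. -/
  incl : F → M
  smooth : ContMDiff (𝓡 n) (𝓡 (n + 1)) ∞ incl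
  isometric (y : F) (v w : TangentSpace (𝓡 n) y) :
    gM.inner (incl y) (mfderiv (𝓡 n) (𝓡 (n + 1)) incl y v)
      (mfderiv (𝓡 n) (𝓡 (n + 1)) incl y w) = gF.inner y v w
  /-- The Gauss map `η`. -/
  normal : Π y : F, TangentSpace (𝓡 (n + 1)) (incl y)
  normal_smooth : ContMDiff (𝓡 n) (𝓡 (n + 1)).tangent ∞
    (fun y => (⟨incl y, normal y⟩ : TangentBundle (𝓡 (n + 1)) M))
  normal_orthogonal (y : F) (v : TangentSpace (𝓡 n) y) :
    gM.inner (incl y) (normal y) (mfderiv (𝓡 n) (𝓡 (n + 1)) incl y v) = 0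
  normal_unit (y : F) : gM.inner (incl y) (normal y) (normal y) = ((κ : ℤ) : ℝ)

variable {gM : SemiRiemannianMetric (𝓡 (n + 1)) M} {gF : SemiRiemannianMetric (𝓡 n) F}

/-- The hypersurface is umbilic: `∇_X η = c X` for all `X ∈ TF`, with a smooth function `c` on `F`.
Here `∇_X η` is the Levi-Civita derivative of `M` of any local extension `N` of `η` to a smooth
vector field of `M`. -/
def IsUmbilic {κ : ℤˣ} (S : OrientedHypersurface gM gF κ) : Prop :=
  ∃ c : F → ℝ, ContMDiff (𝓡 n) 𝓘(ℝ, ℝ) ∞ c ∧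
    ∀ y : F, ∃ N : Π x : M, TangentSpace (𝓡 (n + 1)) x,
      ContMDiffAt (𝓡 (n + 1)) (𝓡 (n + 1)).tangent ∞
        (fun x => (⟨x, N x⟩ : TangentBundle (𝓡 (n + 1)) M)) (S.incl y) ∧
      (∀ᶠ z in 𝓝 y, N (S.incl z) = S.normal z) ∧
      ∀ X : TangentSpace (𝓡 n) y,
        gM.leviCivita N (S.incl y) (mfderiv (𝓡 n) (𝓡 (n + 1)) S.incl y X)
          = c y • mfderiv (𝓡 n) (𝓡 (n + 1)) S.incl y X

variable {ε : Fin (n + 1) → ℤˣ} {p : Fin (n + 1)} {A B : Type*}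

/-- The orthonormal frame of `M` along the hypersurface which consists of `η` (at the position `p`)
and of the frame `b` of the hypersurface. -/
def adaptedFrame (S : OrientedHypersurface gM gF (ε p))
    (σF : SpinStructure B gF (fun i => ε (p.succAbove i))) (b : B) (y : F) :
    Fin (n + 1) → TangentSpace (𝓡 (n + 1)) (S.incl y) :=
  p.insertNth (α := fun _ => TangentSpace (𝓡 (n + 1)) (S.incl y)) (S.normal y)
    (fun i => mfderiv (𝓡 n) (𝓡 (n + 1)) S.incl y (σF.frame b i y))

/-- The data which exhibit `σF` as the spin structure of the hypersurface induced by `σM`: an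
equivariant map of the spin bundle of `F` into the spin bundle of `M`, over the inclusion of the
oriented orthonormal frames of `F` into those of `M` by `(s_i) ↦ (η, s_i)`. In terms of cocycles,
these are smooth lifts `lift b a` to the spin group of the changes from the frame `a` of `M` to the
adapted frame of `b`, which are compatible with both cocycles. -/
structure InducedSpinStructure (S : OrientedHypersurface gM gF (ε p)) (σM : SpinStructure A gM ε)
    (σF : SpinStructure B gF (fun i => ε (p.succAbove i))) where
  /-- The lifts of the changes of frame. -/
  lift : B → A → F → (Cliff ε)ˣ
  lift_mem {b : B} {a : A} {y : F} (hb : y ∈ σF.dom b) (ha : S.incl y ∈ σM.dom a) :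
    lift b a y ∈ spin ε
  lift_smooth (b : B) (a : A) :
    CliffSmoothOn n (fun y => (lift b a y : Cliff ε)) (σF.dom b ∩ S.incl ⁻¹' σM.dom a)
  lift_frame {b : B} {a : A} {y : F} (hb : y ∈ σF.dom b) (ha : S.incl y ∈ σM.dom a)
    (w : TangentSpace (𝓡 (n + 1)) (S.incl y)) :
    (lift b a y : Cliff ε) * vec ε (coords gM ε (fun i => σM.frame a i (S.incl y)) w)
      = vec ε (coords gM ε (adaptedFrame S σF b y) w) * lift b a y
  lift_trans {b : B} {a a' : A} {y : F} (hb : y ∈ σF.dom b) (ha : S.incl y ∈ σM.dom a)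
    (ha' : S.incl y ∈ σM.dom a') :
    lift b a y * σM.trans a a' (S.incl y) = lift b a' y
  trans_lift {b b' : B} {a : A} {y : F} (hb : y ∈ σF.dom b) (hb' : y ∈ σF.dom b')
    (ha : S.incl y ∈ σM.dom a) :
    CliffordAlgebra.map (hyperplane ε p) (σF.trans b b' y : Cliff _) * (lift b' a y : Cliff ε)
      = lift b a y

/-- The restriction `φ|_F` to the hypersurface of a spinor field `φ` of `M`: the value of `φ` in the
gauge of the adapted frame, seen as a spinor of `F` by the identification of the spinor modules. It
does not depend on the gauge `a` of `M` in which `φ` is evaluated. -/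
def restrict {S : OrientedHypersurface gM gF (ε p)} {σM : SpinStructure A gM ε}
    {σF : SpinStructure B gF (fun i => ε (p.succAbove i))}
    (Φ : InducedSpinStructure S σM σF)
    {ΔM ΔF : Type*} [NormedAddCommGroup ΔM] [NormedSpace ℂ ΔM]
    [NormedAddCommGroup ΔF] [NormedSpace ℂ ΔF]
    {ρM : SpinorModule ε ΔM} {ρF : SpinorModule (fun i => ε (p.succAbove i)) ΔF}
    (r : SpinorIdentification p ρM ρF) (φ : A → M → ΔM) : B → F → ΔF :=
  fun b y =>
    let a : A := Classical.choose (σM.exists_mem_dom (S.incl y))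
    r.toLin (ρM.act (Φ.lift b a y : Cliff ε) (φ a (S.incl y)))

end Hypersurface

end SpinGeometry

end

open SpinGeometry

/-! Write `κ = ε p` and `∇_X η = λ X`. The spinorial Gauss formula of an umbilic hypersurface reads
`∇^F_X (φ|_F) = (∇^M_X φ)|_F + (1/2) κ λ X · (η · φ)|_F` (`spinorDeriv_restrict`). A twistor spinor
satisfies `∇^M_X φ = -(1/(n+1)) X · Dφ` (`spinorDeriv_eq_of_twistorOperator_eq_zero`), and
restriction commutes with Clifford multiplication by tangent vectors. Hence `∇^F_X (φ|_F) = X · χ`,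
where `χ = -(1/(n+1)) (Dφ)|_F + (1/2) κ λ (η · φ)|_F` does not involve `X`. Such an equation in
dimension `n` forces `D(φ|_F) = -n χ`, and the twistor operator vanishes
(`twistorOperator_eq_zero_of_spinorDeriv_eq`).

The work lies in the Gauss formula. In gauges, the restriction is `u · φ_a`, where `u` lifts the
change from a frame of `M` to the frame adapted to `F`. Differentiation produces `du`, which
`gauge_change` expresses through the two connection forms: `du + B(Γ') u = u B(Γ)`, with `B` the
bivector of a skew matrix. No Lie algebra of the spin group is needed: the difference of the two
sides, times `u⁻¹`, is even, commutes with all vectors and changes sign under reversal. The first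
two properties make it a scalar, the third makes it zero (`eq_zero_of_commute_of_reverse_eq_neg`).

It remains to compute `Γ'`. Its tangential block is the connection form of `F`, because both are
skew and have the same torsion (`adaptedConnectionForm_tangential`); its normal entries come from
umbilicity (`adaptedConnectionForm_normal`). The adapted frame exists only along `F`, so `Γ'` is
defined through the pulled-back connection: derivatives of the frame's coordinates plus the ambient
connection form. -/

noncomputable section

namespace SpinGeometry

/-! ### Contractions and central elements of the Clifford algebra -/

section CliffordCenter

open CliffordAlgebra

section Exterior

variable {d : ℕ}

/-- The projection of the exterior algebra of `ℝ^d` onto the kernels of the contractions with the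
coordinates in a list. -/
def removeCoords : List (Fin d) →
    CliffordAlgebra (0 : QuadraticForm ℝ (Fin d → ℝ)) →
      CliffordAlgebra (0 : QuadraticForm ℝ (Fin d → ℝ))
  | [], x => x
  | i :: l, x => removeCoords l
      (x - ι 0 (Pi.single i 1) * contractLeft (LinearMap.proj i : Module.Dual ℝ (Fin d → ℝ)) x)

lemma removeCoords_add (l : List (Fin d)) (x y) :
    removeCoords l (x + y) = removeCoords l x + removeCoords l y := by
  induction l generalizing x y with
  | nil => rfl
  | cons i l ih =>
    simp only [removeCoords, ← ih, map_add, mul_add]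
    congr 1; abel

lemma removeCoords_smul (l : List (Fin d)) (c : ℝ) (x) :
    removeCoords l (c • x) = c • removeCoords l x := by
  induction l generalizing x with
  | nil => rfl
  | cons i l ih => simp only [removeCoords, ← ih, map_smul, mul_smul_comm, smul_sub]

lemma removeCoords_zero (l : List (Fin d)) : removeCoords l 0 = 0 := by
  simpa using removeCoords_smul l 0 0

lemma removeCoords_algebraMap (l : List (Fin d)) (c : ℝ) :
    removeCoords l (algebraMap ℝ _ c) = algebraMap ℝ _ c := by
  induction l with
  | nil => rfl
  | cons i l ih => simp [removeCoords, ih]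

lemma removeCoords_eq_self (l : List (Fin d)) {x}
    (hx : ∀ δ : Module.Dual ℝ (Fin d → ℝ), contractLeft δ x = 0) : removeCoords l x = x := by
  induction l with
  | nil => rfl
  | cons i l ih => simp [removeCoords, ih, hx]

lemma ι_zero_mul_ι_self_mul (v : Fin d → ℝ) (x) :
    ι (0 : QuadraticForm ℝ (Fin d → ℝ)) v * (ι 0 v * x) = 0 := by
  rw [← mul_assoc, ι_sq_scalar]; simp

lemma ι_zero_mul_ι_mul (v w : Fin d → ℝ) (x) :
    ι (0 : QuadraticForm ℝ (Fin d → ℝ)) v * (ι 0 w * x) = -(ι 0 w * (ι 0 v * x)) := by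
  rw [← mul_assoc, ← mul_assoc, ← neg_mul, eq_neg_of_add_eq_zero_left
    ((ι_mul_ι_add_swap (Q := (0 : QuadraticForm ℝ (Fin d → ℝ))) v w).trans
      (by simp [QuadraticMap.polar]))]

/-- The step for `i` itself kills `e_i ∧ x` because `e_i ∧ e_i = 0`. The step for `j ≠ i` passes
`e_i` through two factors that each anticommute with it, so the signs cancel. -/
lemma removeCoords_ι_mul (l : List (Fin d)) (i : Fin d) (x) :
    removeCoords l (ι 0 (Pi.single i 1) * x)
      = if i ∈ l then 0 else ι 0 (Pi.single i 1) * removeCoords l x := by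
  induction l generalizing x with
  | nil => simp [removeCoords]
  | cons j l ih =>
    by_cases hij : i = j
    · subst hij
      simp [removeCoords, contractLeft_ι_mul, mul_sub, ι_zero_mul_ι_self_mul, removeCoords_zero]
    · have : Pi.single (M := fun _ => ℝ) i 1 j = 0 := by simp [Ne.symm hij]
      simp only [removeCoords, contractLeft_ι_mul, LinearMap.proj_apply, this, zero_smul, zero_sub,
        mul_neg, List.mem_cons, hij, false_or]
      rw [ι_zero_mul_ι_mul, neg_neg, ← mul_sub, ih]

/-- Removing every coordinate annihilates every product that begins with a vector, so only the
scalar part survives. -/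
lemma exists_algebraMap_eq_removeCoords (x) :
    ∃ c : ℝ, removeCoords (List.finRange d) x = algebraMap ℝ _ c := by
  induction x using CliffordAlgebra.left_induction with
  | algebraMap r => exact ⟨r, removeCoords_algebraMap _ r⟩
  | add x y hx hy =>
    obtain ⟨a, ha⟩ := hx
    obtain ⟨b, hb⟩ := hy
    exact ⟨a + b, by rw [removeCoords_add, ha, hb, map_add]⟩
  | ι_mul x m _ =>
    refine ⟨0, ?_⟩
    have key : ∀ s : Finset (Fin d), removeCoords (List.finRange d)
        (ι 0 (∑ i ∈ s, m i • Pi.single (M := fun _ => ℝ) i (1 : ℝ)) * x) = 0 := by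
      intro s
      induction s using Finset.induction_on with
      | empty => simp [removeCoords_zero]
      | insert i s hi ih =>
        rw [Finset.sum_insert hi, map_add, add_mul, removeCoords_add, ih, map_smul, smul_mul_assoc,
          removeCoords_smul, removeCoords_ι_mul]
        simp
    have hm : m = ∑ i, m i • Pi.single (M := fun _ => ℝ) i (1 : ℝ) := by
      ext j; simp [Finset.sum_apply, Pi.single_apply]
    rw [hm, key, map_zero]

end Exterior

variable {d : ℕ}

/-- An element of a Clifford algebra all of whose contractions vanish is a scalar. -/
lemma exists_algebraMap_of_contractLeft_eq_zero (Q : QuadraticForm ℝ (Fin d → ℝ))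
    {x : CliffordAlgebra Q} (hx : ∀ δ : Module.Dual ℝ (Fin d → ℝ), contractLeft δ x = 0) :
    ∃ c : ℝ, x = algebraMap ℝ _ c := by
  -- The identification with the exterior algebra commutes with contractions and fixes scalars, so
  -- it suffices to argue there: the projection fixes the image of `x` and takes only scalar values.
  let e := equivExterior Q
  have he : ∀ δ : Module.Dual ℝ (Fin d → ℝ),
      contractLeft (Q := (0 : QuadraticForm ℝ (Fin d → ℝ))) δ (e x) = 0 := by
    intro δ
    have := changeForm_contractLeft (changeForm.associated_neg_proof (Q := Q)) δ x
    rw [hx, map_zero] at this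
    exact this.symm
  obtain ⟨c, hc⟩ := exists_algebraMap_eq_removeCoords (e x)
  rw [removeCoords_eq_self _ he] at hc
  refine ⟨c, e.injective ?_⟩
  rw [hc]
  exact (changeForm_algebraMap (changeForm.associated_neg_proof (Q := Q)) c).symm

/-- The graded commutator with a vector is a contraction. -/
lemma ι_mul_sub_involute_mul_ι (Q : QuadraticForm ℝ (Fin d → ℝ)) (v : Fin d → ℝ)
    (x : CliffordAlgebra Q) :
    ι Q v * x - involute x * ι Q v = contractLeft (Q.polarBilin v) x := by
  induction x using CliffordAlgebra.left_induction with
  | algebraMap r => simp [Algebra.commutes]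
  | add x y hx hy => simp only [map_add, ← hx, ← hy, mul_add, add_mul]; abel
  | ι_mul x w hx =>
    rw [contractLeft_ι_mul, ← hx, map_mul, involute_ι, QuadraticMap.polarBilin_apply_apply,
      Algebra.smul_def, ← ι_mul_ι_add_swap]
    noncomm_ring

instance (ε : Fin d → ℤˣ) : Module.Finite ℝ (Cliff ε) :=
  have : Module.Finite ℝ (ExteriorAlgebra ℝ (Fin d → ℝ)) :=
    .of_basis (Pi.basisFun ℝ (Fin d)).ExteriorAlgebra
  .equiv (equivExterior (cliffordForm ε)).symm

lemma polar_cliffordForm (ε : Fin d → ℤˣ) (v w : Fin d → ℝ) :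
    QuadraticMap.polar (cliffordForm ε) v w = -2 * ∑ i, ((ε i : ℤ) : ℝ) * v i * w i := by
  simp only [QuadraticMap.polar, cliffordForm, QuadraticMap.weightedSumSquares_apply, Pi.add_apply,
    smul_eq_mul, Finset.mul_sum, ← Finset.sum_sub_distrib]
  exact Finset.sum_congr rfl fun i _ => by ring

lemma sign_mul_self (e : ℤˣ) : ((e : ℤ) : ℝ) * ((e : ℤ) : ℝ) = 1 := by
  rcases Int.units_eq_one_or e with rfl | rfl <;> simp

lemma eq_zero_of_commute_of_reverse_eq_neg (ε : Fin d → ℤˣ) {x : Cliff ε}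
    (hx : involute x = x) (hc : ∀ i, x * basisVec ε i = basisVec ε i * x)
    (hr : reverse x = -x) : x = 0 := by
  have h1 : ∀ δ : Module.Dual ℝ (Fin d → ℝ), contractLeft δ x = 0 := by
    intro δ
    -- By nondegeneracy every functional is a polar form: `e_i` pairs to `-2 ε_i` with itself and to
    -- `0` with the other basis vectors, and the inverse of `-2 ε_i` is `-(1/2) ε_i`.
    have hδ : δ = ∑ i, (-(1 / 2) * ((ε i : ℤ) : ℝ) * δ (Pi.single i 1)) •
        (cliffordForm ε).polarBilin (Pi.single i 1) := by
      refine LinearMap.pi_ext' fun j => LinearMap.ext_ring ?_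
      simp [polar_cliffordForm, Pi.single_apply, Finset.sum_ite_eq]
      linear_combination (-δ (Pi.single j 1)) * sign_mul_self (ε j)
    rw [hδ, map_sum, LinearMap.sum_apply]
    refine Finset.sum_eq_zero fun i _ => ?_
    rw [map_smul, LinearMap.smul_apply, ← ι_mul_sub_involute_mul_ι, hx]
    have := hc i
    rw [basisVec] at this
    simp [this]
  obtain ⟨c, rfl⟩ := exists_algebraMap_of_contractLeft_eq_zero _ h1
  rw [reverse.commutes, eq_neg_iff_add_eq_zero, ← map_add] at hr
  have : c + c = 0 := by
    by_contra h
    have := (isUnit_iff_ne_zero.2 h).map (algebraMap ℝ (Cliff ε))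
    rw [hr] at this
    have hn : Nontrivial (Cliff ε) := inferInstance
    exact not_isUnit_zero this
  rw [show c = 0 by linarith, map_zero]

end CliffordCenter

/-! ### Bivectors and the change of connection forms under a change of gauge -/

section Bivectors

open CliffordAlgebra

variable {d : ℕ} (ε : Fin d → ℤˣ)

/-- The element of the Clifford algebra which belongs to a skew-symmetric matrix. -/
def bivector (Γ : Fin d → Fin d → ℝ) : Cliff ε :=
  (1 / 2 : ℝ) • ∑ k, ∑ l ∈ Finset.univ.filter (fun l => k < l),
    (((ε k : ℤ) : ℝ) * ((ε l : ℤ) : ℝ) * Γ k l) • (basisVec ε k * basisVec ε l)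

lemma basisVec_mul_basisVec_add_swap (i j : Fin d) :
    basisVec ε i * basisVec ε j + basisVec ε j * basisVec ε i
      = algebraMap ℝ _ (if i = j then -2 * ((ε i : ℤ) : ℝ) else 0) := by
  rw [basisVec, basisVec, ι_mul_ι_add_swap, polar_cliffordForm]
  congr 1
  rcases eq_or_ne i j with rfl | h
  · simp [Pi.single_apply]
  · simp [Pi.single_apply, h, h.symm]

lemma basisVec_mul_self (i : Fin d) :
    basisVec ε i * basisVec ε i = algebraMap ℝ _ (-((ε i : ℤ) : ℝ)) := by
  have := basisVec_mul_basisVec_add_swap ε i i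
  rw [if_pos rfl, ← two_smul ℝ] at this
  calc basisVec ε i * basisVec ε i = (1 / 2 : ℝ) • (2 : ℝ) • (basisVec ε i * basisVec ε i) := by
        rw [smul_smul]; norm_num
    _ = algebraMap ℝ _ (-((ε i : ℤ) : ℝ)) := by
        rw [this, Algebra.smul_def, ← map_mul]
        congr 1; ring

lemma vec_eq_sum (v : Fin d → ℝ) : vec ε v = ∑ i, v i • basisVec ε i := by
  have hm : v = ∑ i, v i • Pi.single (M := fun _ => ℝ) i (1 : ℝ) := by
    ext j; simp [Finset.sum_apply, Pi.single_apply]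
  conv_lhs => rw [hm]
  simp [basisVec]

variable {ε} {Γ : Fin d → Fin d → ℝ}

/-- Both `Γ k l` and `e_k e_l` change sign when `k ≠ l` are exchanged, so the summand is symmetric;
it vanishes on the diagonal. The unordered form makes reversal and commutators easy to compute. -/
lemma bivector_eq_sum (hΓ : ∀ k l, Γ k l = -Γ l k) :
    bivector ε Γ = (1 / 4 : ℝ) • ∑ k, ∑ l,
      (((ε k : ℤ) : ℝ) * ((ε l : ℤ) : ℝ) * Γ k l) • (basisVec ε k * basisVec ε l) := by
  set G : Fin d → Fin d → Cliff ε := fun k l =>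
    (((ε k : ℤ) : ℝ) * ((ε l : ℤ) : ℝ) * Γ k l) • (basisVec ε k * basisVec ε l) with hG
  have hsymm : ∀ k l, G k l = G l k := by
    intro k l
    rcases eq_or_ne k l with rfl | h
    · rfl
    have := basisVec_mul_basisVec_add_swap ε k l
    rw [if_neg h, map_zero] at this
    simp only [hG, eq_neg_of_add_eq_zero_left this, hΓ k l, smul_neg, mul_neg, neg_smul, neg_neg]
    rw [mul_comm ((ε k : ℤ) : ℝ)]
  have hdiag : ∀ k, G k k = 0 := by
    intro k
    have : Γ k k = 0 := by linarith [hΓ k k]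
    simp [hG, this]
  have h1 : ∑ k, ∑ l, G k l = (2 : ℝ) • ∑ k, ∑ l ∈ Finset.univ.filter (fun l => k < l), G k l := by
    have h2 : ∀ k, ∑ l, G k l = ∑ l ∈ Finset.univ.filter (fun l => k < l), G k l
        + ∑ l ∈ Finset.univ.filter (fun l => l < k), G k l := by
      intro k
      simp only [Finset.sum_filter, ← Finset.sum_add_distrib]
      refine Finset.sum_congr rfl fun l _ => ?_
      rcases lt_trichotomy k l with h | h | h
      · simp [h, h.not_gt]
      · subst h; simp [hdiag]
      · simp [h, h.not_gt]
    rw [Finset.sum_congr rfl fun k _ => h2 k, Finset.sum_add_distrib, two_smul]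
    congr 1
    simp only [Finset.sum_filter]
    rw [Finset.sum_comm]
    exact Finset.sum_congr rfl fun k _ => Finset.sum_congr rfl fun l _ => by rw [hsymm]
  rw [h1, smul_smul, bivector]
  norm_num
  rfl

lemma involute_bivector : involute (bivector ε Γ) = bivector ε Γ := by
  simp [bivector, basisVec]

lemma reverse_bivector (hΓ : ∀ k l, Γ k l = -Γ l k) :
    reverse (bivector ε Γ) = -bivector ε Γ := by
  simp only [bivector_eq_sum hΓ, map_smul, map_sum, reverse.map_mul, basisVec, reverse_ι]
  rw [← smul_neg, Finset.sum_comm, ← Finset.sum_neg_distrib]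
  congr 1
  refine Finset.sum_congr rfl fun k _ => ?_
  rw [← Finset.sum_neg_distrib]
  refine Finset.sum_congr rfl fun l _ => ?_
  rw [hΓ l k, ← neg_smul]
  congr 1; ring

/-- A skew-symmetric matrix acts on vectors as the commutator with its bivector. -/
lemma bivector_mul_basisVec_sub (hΓ : ∀ k l, Γ k l = -Γ l k) (m : Fin d) :
    bivector ε Γ * basisVec ε m - basisVec ε m * bivector ε Γ
      = vec ε (fun l => ((ε l : ℤ) : ℝ) * Γ m l) := by
  -- The commutator of a product with a vector, through anticommutators: `[ab, c] = a {b, c} - {a,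
  -- c} b`.
  have hcomm : ∀ k l, basisVec ε k * basisVec ε l * basisVec ε m
      - basisVec ε m * (basisVec ε k * basisVec ε l)
      = (if l = m then -2 * ((ε l : ℤ) : ℝ) else 0) • basisVec ε k
        - (if k = m then -2 * ((ε k : ℤ) : ℝ) else 0) • basisVec ε l := by
    intro k l
    rw [Algebra.smul_def, Algebra.smul_def, ← basisVec_mul_basisVec_add_swap,
      ← basisVec_mul_basisVec_add_swap, basisVec_mul_basisVec_add_swap, Algebra.commutes,
      ← basisVec_mul_basisVec_add_swap]
    noncomm_ring
  rw [bivector_eq_sum hΓ, smul_mul_assoc, mul_smul_comm, ← smul_sub, Finset.sum_mul,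
    Finset.mul_sum, ← Finset.sum_sub_distrib]
  simp only [Finset.sum_mul, Finset.mul_sum, ← Finset.sum_sub_distrib, smul_mul_assoc,
    mul_smul_comm, ← smul_sub, hcomm]
  simp only [ite_smul, zero_smul, smul_sub, smul_ite, smul_zero, Finset.sum_sub_distrib,
    Finset.sum_ite_eq', Finset.mem_univ, if_true]
  rw [Finset.sum_comm (f := fun k l => if k = m then _ else _)]
  simp only [Finset.sum_ite_eq', Finset.mem_univ, if_true, smul_smul, Finset.smul_sum]
  rw [← Finset.sum_sub_distrib, vec_eq_sum]
  refine Finset.sum_congr rfl fun l _ => ?_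
  rw [← sub_smul, hΓ l m]
  congr 1
  linear_combination ((ε l : ℤ) : ℝ) * Γ m l * sign_mul_self (ε m)

/-- The transformation of the connection form under a change of gauge `u` of the spin bundle, where
`c` is the corresponding change of frame, and `u'`, `c'` are the derivatives of `u` and `c`. -/
lemma gauge_change {Γ' : Fin d → Fin d → ℝ} (hΓ : ∀ k l, Γ k l = -Γ l k)
    (hΓ' : ∀ k l, Γ' k l = -Γ' l k) (u : (Cliff ε)ˣ) (u' : Cliff ε) (c c' : Fin d → Fin d → ℝ)
    {N : ℝ} (hu : involute (u : Cliff ε) = u) (hu' : involute u' = u')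
    (hN : reverse (u : Cliff ε) * u = algebraMap ℝ _ N)
    (hN' : reverse u' * u + reverse (u : Cliff ε) * u' = 0)
    (hc : ∀ k, (u : Cliff ε) * vec ε (c k) = basisVec ε k * u)
    (hc' : ∀ k, u' * vec ε (c k) + u * vec ε (c' k) = basisVec ε k * u')
    (hΓΓ' : ∀ k, (u : Cliff ε) * vec ε (fun l => c' k l + ∑ m, c k m * (((ε l : ℤ) : ℝ) * Γ m l))
      = vec ε (fun l => ((ε l : ℤ) : ℝ) * Γ' k l) * u) :
    u' + bivector ε Γ' * u = u * bivector ε Γ := by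
  set w : Cliff ε := ((u⁻¹ : (Cliff ε)ˣ) : Cliff ε) with hw
  have huw : (u : Cliff ε) * w = 1 := u.mul_inv
  have hwu : w * (u : Cliff ε) = 1 := u.inv_mul
  have hwi : involute w = w := by
    have h1 : involute w * (u : Cliff ε) = 1 := by
      have h2 := congrArg involute hwu
      rwa [map_mul, hu, map_one] at h2
    rw [← mul_one (involute w), ← huw, ← mul_assoc, h1, one_mul]
  -- Reversal of `u` is inversion up to the scalar `N`. Together with `hN'` this makes `u' u⁻¹`
  -- change sign under reversal, as a bivector does.
  have hru : reverse (u : Cliff ε) = N • w := by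
    rw [← mul_one (reverse (u : Cliff ε)), ← huw, ← mul_assoc, hN, Algebra.smul_def]
  have hrw : N • reverse w = u := by
    have h1 : reverse w * reverse (u : Cliff ε) = 1 := by
      rw [← reverse.map_mul, huw, reverse.map_one]
    rw [hru, mul_smul_comm, ← smul_mul_assoc] at h1
    rw [← mul_one (N • reverse w), ← hwu, ← mul_assoc, h1, one_mul]
  have hru' : reverse u' = -(N • (w * u' * w)) := by
    rw [← mul_one (reverse u'), ← huw, ← mul_assoc, eq_neg_of_add_eq_zero_left hN', hru]
    simp only [neg_mul, smul_mul_assoc]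
  have hrr : reverse w * reverse u' = -(u' * w) := by
    rw [hru', mul_neg, mul_smul_comm, ← smul_mul_assoc, hrw, ← mul_assoc, ← mul_assoc, huw, one_mul]
  have hcw : ∀ k, w * basisVec ε k = vec ε (c k) * w := by
    intro k
    calc w * basisVec ε k = w * (basisVec ε k * u) * w := by
          rw [mul_assoc, mul_assoc, huw, mul_one]
      _ = vec ε (c k) * w := by rw [← hc, ← mul_assoc, hwu, one_mul]
  have hB : ∀ k, bivector ε Γ * vec ε (c k) - vec ε (c k) * bivector ε Γ
      = vec ε (fun l => ∑ m, c k m * (((ε l : ℤ) : ℝ) * Γ m l)) := by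
    intro k
    have h1 : (fun l => ∑ m, c k m * (((ε l : ℤ) : ℝ) * Γ m l))
        = ∑ m, c k m • fun l => ((ε l : ℤ) : ℝ) * Γ m l := by
      ext l; simp
    rw [vec_eq_sum ε (c k), h1, map_sum, Finset.mul_sum, Finset.sum_mul, ← Finset.sum_sub_distrib]
    refine Finset.sum_congr rfl fun m _ => ?_
    rw [map_smul, ← bivector_mul_basisVec_sub hΓ, mul_smul_comm, smul_mul_assoc, smul_sub]
  -- The difference of the two sides, multiplied by `u⁻¹`. It commutes with vectors because the
  -- terms of the differentiated frame relation `hc'` cancel the commutators of the two bivectors,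
  -- by `hΓΓ'`.
  have hz : u' * w + bivector ε Γ' - u * bivector ε Γ * w = 0 := by
    refine eq_zero_of_commute_of_reverse_eq_neg ε ?_ (fun k => ?_) ?_
    · simp only [map_add, map_sub, map_mul, involute_bivector, hu, hu', hwi]
    · rw [← sub_eq_zero]
      have h2 : vec ε (fun l => ((ε l : ℤ) : ℝ) * Γ' k l)
          = u * vec ε (fun l => c' k l + ∑ m, c k m * (((ε l : ℤ) : ℝ) * Γ m l)) * w := by
        rw [hΓΓ', mul_assoc, huw, mul_one]
      have h3 : vec ε (fun l => c' k l + ∑ m, c k m * (((ε l : ℤ) : ℝ) * Γ m l))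
          = vec ε (c' k) + (bivector ε Γ * vec ε (c k) - vec ε (c k) * bivector ε Γ) := by
        rw [hB, ← map_add]; rfl
      have h4 := bivector_mul_basisVec_sub (ε := ε) hΓ' k
      rw [h2, h3, mul_add, eq_sub_of_add_eq' (hc' k), add_mul, sub_mul] at h4
      calc _ = (u' * (w * basisVec ε k) - basisVec ε k * u' * w)
            + (bivector ε Γ' * basisVec ε k - basisVec ε k * bivector ε Γ')
            - (u * bivector ε Γ * (w * basisVec ε k)
              - (basisVec ε k * u) * bivector ε Γ * w) := by noncomm_ring
        _ = 0 := by
          rw [h4, hcw, ← hc]; noncomm_ring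
    · simp only [map_add, map_sub, reverse.map_mul, reverse_bivector hΓ, reverse_bivector hΓ', hrr,
        hru]
      have : reverse w * (-bivector ε Γ * N • w) = -(u * bivector ε Γ * w) := by
        rw [mul_smul_comm, mul_smul_comm, ← smul_mul_assoc, hrw]; noncomm_ring
      rw [this]; abel
  have h5 := congrArg (fun z => z * (u : Cliff ε)) hz
  simp only [sub_mul, add_mul, mul_assoc, hwu, mul_one, zero_mul] at h5
  rwa [sub_eq_zero] at h5

end Bivectors

/-! ### Calculus for functions with values in spaces without a norm -/

section WeakDeriv

variable {E : Type*} [NormedAddCommGroup E] [NormedSpace ℝ E]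
  {H : Type*} [TopologicalSpace H] {I : ModelWithCorners ℝ E H}
  {M : Type*} [TopologicalSpace M] [ChartedSpace H M]
  {E' : Type*} [NormedAddCommGroup E'] [NormedSpace ℝ E']
  {H' : Type*} [TopologicalSpace H'] {I' : ModelWithCorners ℝ E' H'}
  {M' : Type*} [TopologicalSpace M'] [ChartedSpace H' M']
  {V W U : Type*} [AddCommGroup V] [Module ℝ V] [AddCommGroup W] [Module ℝ W]
  [AddCommGroup U] [Module ℝ U]

variable (I) in
/-- `D` is the derivative at `x` of the function `f` with values in a real vector space (which needs
no norm): all linear functionals of `f` are differentiable with the corresponding derivative. -/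
def HasWeakDeriv (f : M → V) (x : M) (D : TangentSpace I x → V) : Prop :=
  ∀ l : Module.Dual ℝ V, MDifferentiableAt I 𝓘(ℝ, ℝ) (fun y => l (f y)) x ∧
    ∀ v, mvfderiv I (fun y => l (f y)) x v = l (D v)

variable (I) in
/-- Smoothness at `x` of a function with values in a real vector space (which needs no norm): all
its linear functionals are smooth. -/
def WeaklySmoothAt (f : M → V) (x : M) : Prop :=
  ∀ l : Module.Dual ℝ V, ContMDiffAt I 𝓘(ℝ, ℝ) ∞ (fun y => l (f y)) x

variable {x : M}

lemma mvfderiv_sum {ι : Type*} (s : Finset ι) {f : ι → M → ℝ}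
    (hf : ∀ i ∈ s, MDifferentiableAt I 𝓘(ℝ, ℝ) (f i) x) :
    MDifferentiableAt I 𝓘(ℝ, ℝ) (fun y => ∑ i ∈ s, f i y) x ∧
      mvfderiv I (fun y => ∑ i ∈ s, f i y) x = ∑ i ∈ s, mvfderiv I (f i) x := by
  classical
  induction s using Finset.induction_on with
  | empty => exact ⟨by simpa using mdifferentiableAt_const, by simpa using mvfderiv_const (0 : ℝ)⟩
  | insert i s hi ih =>
    have h1 := hf i (Finset.mem_insert_self i s)
    have h2 := ih fun j hj => hf j (Finset.mem_insert_of_mem hj)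
    simp only [Finset.sum_insert hi]
    exact ⟨h1.add h2.1, by rw [mvfderiv_fun_add h1 h2.1, h2.2]⟩

lemma mvfderiv_congr {F : Type*} [NormedAddCommGroup F] [NormedSpace ℝ F] {f g : M → F}
    (h : f =ᶠ[𝓝 x] g) : mvfderiv I f x = mvfderiv I g x := by
  have h0 : f x = g x := h.eq_of_nhds
  ext v
  simp only [mvfderiv, h.mfderiv_eq]
  rfl

namespace HasWeakDeriv

variable {f : M → V} {g : M → W} {D : TangentSpace I x → V} {D' : TangentSpace I x → W}

lemma congr (hf : HasWeakDeriv I f x D) {f' : M → V} (h : f' =ᶠ[𝓝 x] f) :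
    HasWeakDeriv I f' x D := fun l => by
  have h' : (fun y => l (f' y)) =ᶠ[𝓝 x] fun y => l (f y) := h.fun_comp l
  exact ⟨(hf l).1.congr_of_eventuallyEq h', fun v => by rw [mvfderiv_congr h', (hf l).2]⟩

/-- Linear functionals separate points. With `congr`, this is the means of differentiating an
identity that holds near `x`. -/
lemma unique (hf : HasWeakDeriv I f x D) {D₂ : TangentSpace I x → V}
    (hf' : HasWeakDeriv I f x D₂) : D = D₂ := by
  ext v
  rw [← sub_eq_zero, ← Module.forall_dual_apply_eq_zero_iff ℝ]
  intro l
  rw [map_sub, ← (hf l).2, ← (hf' l).2, sub_self]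

lemma const (c : V) : HasWeakDeriv I (fun _ : M => c) x 0 := fun l =>
  ⟨mdifferentiableAt_const, fun v => by rw [mvfderiv_const]; simp⟩

lemma linear (hf : HasWeakDeriv I f x D) (L : V →ₗ[ℝ] W) :
    HasWeakDeriv I (fun y => L (f y)) x (fun v => L (D v)) := fun l => hf (l ∘ₗ L)

lemma real {h : M → ℝ} (hh : MDifferentiableAt I 𝓘(ℝ, ℝ) h x) :
    HasWeakDeriv I h x (fun v => mvfderiv I h x v) := fun l => by
  have h1 : ∀ r, l r = r * l 1 := fun r => by
    rw [← smul_eq_mul, ← map_smul, smul_eq_mul, mul_one]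
  simp only [fun y => h1 (h y)]
  refine ⟨hh.mul mdifferentiableAt_const, fun v => ?_⟩
  rw [mvfderiv_fun_mul hh mdifferentiableAt_const, mvfderiv_const, h1 (mvfderiv I h x v)]
  simp [mul_comm]

lemma mdifferentiableAt {h : M → ℝ} {D : TangentSpace I x → ℝ} (hh : HasWeakDeriv I h x D) :
    MDifferentiableAt I 𝓘(ℝ, ℝ) h x := (hh LinearMap.id).1

lemma mvfderiv_eq {h : M → ℝ} {D : TangentSpace I x → ℝ} (hh : HasWeakDeriv I h x D)
    (v : TangentSpace I x) : mvfderiv I h x v = D v := (hh LinearMap.id).2 v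

end HasWeakDeriv

/-- Expansion in bases reduces the product rule for bilinear maps to that for real functions;
nothing is needed of the target space. -/
lemma exists_dual_bilin_eq_sum [Module.Finite ℝ V] [Module.Finite ℝ W] (β : V →ₗ[ℝ] W →ₗ[ℝ] U)
    (l : Module.Dual ℝ U) : ∃ (m n : ℕ) (p : Fin m → Module.Dual ℝ V) (q : Fin n → Module.Dual ℝ W)
      (K : Fin m → Fin n → ℝ), ∀ v w, l (β v w) = ∑ i, ∑ j, p i v * q j w * K i j := by
  let b := Module.finBasis ℝ V
  let c := Module.finBasis ℝ W
  refine ⟨_, _, fun i => b.coord i, fun j => c.coord j, fun i j => l (β (b i) (c j)),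
    fun v w => ?_⟩
  conv_lhs => rw [← b.sum_repr v, ← c.sum_repr w]
  simp only [map_sum, LinearMap.sum_apply, map_smul, LinearMap.smul_apply,
    smul_eq_mul, Module.Basis.coord_apply]
  simp only [Finset.mul_sum]
  rw [Finset.sum_comm]
  exact Finset.sum_congr rfl fun i _ => Finset.sum_congr rfl fun j _ => by ring

namespace HasWeakDeriv

variable {f : M → V} {g : M → W} {D : TangentSpace I x → V} {D' : TangentSpace I x → W}
  [Module.Finite ℝ V] [Module.Finite ℝ W]

lemma bilinear (hf : HasWeakDeriv I f x D) (hg : HasWeakDeriv I g x D') (β : V →ₗ[ℝ] W →ₗ[ℝ] U) :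
    HasWeakDeriv I (fun y => β (f y) (g y)) x (fun v => β (D v) (g x) + β (f x) (D' v)) := by
  intro l
  obtain ⟨m, n, p, q, K, hK⟩ := exists_dual_bilin_eq_sum β l
  simp only [map_add, hK]
  have h1 : ∀ i j, MDifferentiableAt I 𝓘(ℝ, ℝ) (fun y => p i (f y) * q j (g y) * K i j) x :=
    fun i j => ((hf (p i)).1.mul (hg (q j)).1).mul mdifferentiableAt_const
  have h2 := fun i => mvfderiv_sum (I := I) (x := x) Finset.univ fun j _ => h1 i j
  have h3 := mvfderiv_sum (I := I) (x := x) Finset.univ fun i _ => (h2 i).1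
  refine ⟨h3.1, fun v => ?_⟩
  rw [h3.2, sum_apply, ← Finset.sum_add_distrib]
  refine Finset.sum_congr rfl fun i _ => ?_
  rw [(h2 i).2, sum_apply, ← Finset.sum_add_distrib]
  refine Finset.sum_congr rfl fun j _ => ?_
  have hm : MDifferentiableAt I 𝓘(ℝ, ℝ) (fun y => p i (f y) * q j (g y)) x :=
    (hf (p i)).1.mul (hg (q j)).1
  rw [mvfderiv_fun_mul hm mdifferentiableAt_const, mvfderiv_const,
    mvfderiv_fun_mul (hf (p i)).1 (hg (q j)).1]
  simp only [add_apply, smul_apply, (hf (p i)).2, (hg (q j)).2, smul_eq_mul, zero_apply]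
  ring

/-- The chain rule. -/
lemma comp {V : Type*} [AddCommGroup V] [Module ℝ V] {ψ : M' → M} {y : M'} {f : M → V}
    {D : TangentSpace I (ψ y) → V} (hf : HasWeakDeriv I f (ψ y) D)
    (hψ : MDifferentiableAt I' I ψ y) :
    HasWeakDeriv I' (fun z => f (ψ z)) y (fun v => D (mfderiv I' I ψ y v)) := fun l => by
  refine ⟨(hf l).1.comp y hψ, fun v => ?_⟩
  rw [← (hf l).2]
  exact mvfderiv_comp_apply y (hf l).1 hψ v

end HasWeakDeriv

namespace WeaklySmoothAt

variable {f : M → V} {g : M → W}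

lemma congr (hf : WeaklySmoothAt I f x) {f' : M → V} (h : f' =ᶠ[𝓝 x] f) :
    WeaklySmoothAt I f' x := fun l => (hf l).congr_of_eventuallyEq (h.fun_comp l)

lemma linear (hf : WeaklySmoothAt I f x) (L : V →ₗ[ℝ] W) :
    WeaklySmoothAt I (fun y => L (f y)) x := fun l => hf (l ∘ₗ L)

lemma comp {ψ : M' → M} {y : M'} (hf : WeaklySmoothAt I f (ψ y)) (hψ : ContMDiffAt I' I ∞ ψ y) :
    WeaklySmoothAt I' (fun z => f (ψ z)) y := fun l => (hf l).comp y hψ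

variable [Module.Finite ℝ V] [Module.Finite ℝ W]

lemma bilinear (hf : WeaklySmoothAt I f x) (hg : WeaklySmoothAt I g x) (β : V →ₗ[ℝ] W →ₗ[ℝ] U) :
    WeaklySmoothAt I (fun y => β (f y) (g y)) x := by
  intro l
  obtain ⟨m, n, p, q, K, hK⟩ := exists_dual_bilin_eq_sum β l
  simp only [hK]
  exact contMDiffAt_finsetSum fun i _ => contMDiffAt_finsetSum fun j _ =>
    ((hf (p i)).mul (hg (q j))).mul contMDiffAt_const

lemma exists_hasWeakDeriv (hf : WeaklySmoothAt I f x) :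
    ∃ D : TangentSpace I x → V, HasWeakDeriv I f x D := by
  let b := Module.finBasis ℝ V
  refine ⟨fun v => ∑ i, mvfderiv I (fun y => b.coord i (f y)) x v • b i, fun l => ?_⟩
  have hd := fun l : Module.Dual ℝ V => (hf l).mdifferentiableAt (by simp)
  refine ⟨hd l, fun v => ?_⟩
  have h1 : (fun y => l (f y)) = fun y => ∑ i, b.coord i (f y) * l (b i) := by
    ext y
    conv_lhs => rw [← b.sum_repr (f y)]
    simp only [map_sum, map_smul, smul_eq_mul, Module.Basis.coord_apply]
  have h2 := mvfderiv_sum (I := I) (x := x) Finset.univ fun i _ =>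
    (hd (b.coord i)).mul (mdifferentiableAt_const (c := l (b i)))
  rw [h1]
  refine (congrArg (fun T => T v) h2.2).trans ?_
  rw [sum_apply, map_sum]
  refine Finset.sum_congr rfl fun i _ => ?_
  rw [mvfderiv_mul (hd (b.coord i)) mdifferentiableAt_const, mvfderiv_const]
  simp [mul_comm]

end WeaklySmoothAt

section Normed

variable {Δ : Type*} [NormedAddCommGroup Δ] [NormedSpace ℝ Δ] [FiniteDimensional ℝ Δ] {f : M → Δ}

lemma weaklySmoothAt_iff : WeaklySmoothAt I f x ↔ ContMDiffAt I 𝓘(ℝ, Δ) ∞ f x := by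
  constructor
  · intro hf
    let e := (Module.finBasis ℝ Δ).equivFunL
    have h1 : ContMDiffAt I 𝓘(ℝ, Fin _ → ℝ) ∞ (fun y => e (f y)) x :=
      contMDiffAt_pi_space.2 fun i => hf ((Module.finBasis ℝ Δ).coord i)
    have h2 := (e.symm.contDiff (n := ∞)).contMDiff.contMDiffAt.comp x h1
    refine h2.congr_of_eventuallyEq (.of_forall fun y => ?_)
    simp
  · intro hf l
    exact (l.toContinuousLinearMap.contDiff (n := ∞)).contMDiff.contMDiffAt.comp x hf

lemma hasWeakDeriv_mvfderiv (hf : MDifferentiableAt I 𝓘(ℝ, Δ) f x) :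
    HasWeakDeriv I f x (fun v => mvfderiv I f x v) := fun l => by
  have hl : MDifferentiableAt 𝓘(ℝ, Δ) 𝓘(ℝ, ℝ) l.toContinuousLinearMap (f x) :=
    l.toContinuousLinearMap.differentiableAt.mdifferentiableAt
  refine ⟨hl.comp x hf, fun v => ?_⟩
  refine (mvfderiv_comp_apply x hl hf v).trans ?_
  simp only [mvfderiv, mfderiv_eq_fderiv, ContinuousLinearMap.fderiv]
  rfl

end Normed

end WeakDeriv

/-! ### Elements of the spin group -/

section Spin

open CliffordAlgebra

variable {d : ℕ} {ε : Fin d → ℤˣ}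

lemma involute_eq_self_of_mem_spin {u : (Cliff ε)ˣ} (hu : u ∈ spin ε) :
    involute (u : Cliff ε) = u := by
  induction hu using Subgroup.closure_induction with
  | mem u h =>
    obtain ⟨v, w, _, _, h⟩ := h
    rw [h]
    simp
  | one => simp
  | mul u v _ _ hu hv => rw [Units.val_mul, map_mul, hu, hv]
  | inv u _ hu =>
    have h1 : involute ((u⁻¹ : (Cliff ε)ˣ) : Cliff ε) * u = 1 := by
      have h2 := congrArg involute u.inv_mul
      rwa [map_mul, hu, map_one] at h2
    rw [← mul_one (involute ((u⁻¹ : (Cliff ε)ˣ) : Cliff ε)), ← u.mul_inv, ← mul_assoc, h1, one_mul]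

/-- For a generator `v w` the product telescopes to the two squares, each `±1`; scalars are central,
so the property passes to products and inverses. In indefinite signature `N = -1` can occur. -/
lemma exists_reverse_mul_self_of_mem_spin {u : (Cliff ε)ˣ} (hu : u ∈ spin ε) :
    ∃ N : ℝ, N * N = 1 ∧ reverse (u : Cliff ε) * u = algebraMap ℝ _ N := by
  induction hu using Subgroup.closure_induction with
  | mem u h =>
    obtain ⟨v, w, hv, hw, h⟩ := h
    refine ⟨cliffordForm ε v * cliffordForm ε w, ?_, ?_⟩
    · rcases hv with hv | hv <;> rcases hw with hw | hw <;> simp [hv, hw]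
    · rw [h, reverse.map_mul, reverse_ι, reverse_ι]
      calc _ = vec ε w * (vec ε v * vec ε v) * vec ε w := by noncomm_ring
        _ = _ := by
          rw [ι_sq_scalar, ← Algebra.commutes, mul_assoc, ι_sq_scalar, map_mul]
  | one => exact ⟨1, by simp, by simp⟩
  | mul u v _ _ hu hv =>
    obtain ⟨a, ha, hu⟩ := hu
    obtain ⟨b, hb, hv⟩ := hv
    refine ⟨a * b, by linear_combination b * b * ha + hb, ?_⟩
    rw [Units.val_mul, reverse.map_mul]
    calc _ = reverse (v : Cliff ε) * (reverse (u : Cliff ε) * u) * v := by noncomm_ring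
      _ = _ := by rw [hu, ← Algebra.commutes, mul_assoc, hv, map_mul]
  | inv u _ hu =>
    obtain ⟨a, ha, hu⟩ := hu
    refine ⟨a, ha, ?_⟩
    set w : Cliff ε := ((u⁻¹ : (Cliff ε)ˣ) : Cliff ε) with hw
    have huw : (u : Cliff ε) * w = 1 := u.mul_inv
    have h1 : reverse w * reverse (u : Cliff ε) = 1 := by
      rw [← reverse.map_mul, huw, reverse.map_one]
    have h2 : reverse w * (reverse (u : Cliff ε) * u) * w = 1 := by
      rw [← mul_assoc, h1, one_mul, huw]
    rw [hu, ← Algebra.commutes, mul_assoc] at h2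
    calc reverse w * w = algebraMap ℝ _ a * (algebraMap ℝ _ a * (reverse w * w)) := by
          rw [← mul_assoc, ← map_mul, ha, map_one, one_mul]
      _ = algebraMap ℝ _ a := by rw [h2, mul_one]

lemma vec_injective (ε : Fin d → ℤˣ) : Function.Injective (vec ε) := fun v w h =>
  (ExteriorAlgebra.ι_leftInverse (R := ℝ) (M := Fin d → ℝ)).injective <| by
    simpa [equivExterior] using congrArg (equivExterior (cliffordForm ε)) h

lemma exists_linear_leftInverse_vec (ε : Fin d → ℤˣ) :
    ∃ L : Cliff ε →ₗ[ℝ] (Fin d → ℝ), ∀ v, L (vec ε v) = v := by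
  obtain ⟨L, hL⟩ := LinearMap.exists_leftInverse_of_injective (vec ε)
    (LinearMap.ker_eq_bot.2 (vec_injective ε))
  exact ⟨L, fun v => congrArg (fun T => T v) hL⟩

/-- Such a functional reads off the number from a scalar of the Clifford algebra, which lets the
norm of a lift be treated as a smooth real function. -/
lemma exists_dual_one_eq_one (ε : Fin d → ℤˣ) : ∃ l : Module.Dual ℝ (Cliff ε), l 1 = 1 := by
  have hn : Nontrivial (Cliff ε) := inferInstance
  obtain ⟨l, hl⟩ := Module.Projective.exists_dual_ne_zero ℝ (one_ne_zero (α := Cliff ε))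
  exact ⟨(l 1)⁻¹ • l, by simp [hl]⟩

end Spin

/-! ### The Lie bracket as a commutator of derivations -/

section LieBracket

lemma two_le_infty : (2 : ℕ∞ω) ≤ ∞ :=
  show ((2 : ℕ∞) : ℕ∞ω) ≤ ((⊤ : ℕ∞) : ℕ∞ω) from WithTop.coe_le_coe.2 le_top

variable {E : Type*} [NormedAddCommGroup E] [NormedSpace ℝ E]
  {H : Type*} [TopologicalSpace H] {I : ModelWithCorners ℝ E H}
  {M : Type*} [TopologicalSpace M] [ChartedSpace H M] [IsManifold I ∞ M]

lemma mvfderiv_comp_extChartAt {k : M → ℝ} {K : E → ℝ} {x y : M} (hy : y ∈ (chartAt H x).source)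
    (hk : k =ᶠ[𝓝 y] K ∘ extChartAt I x)
    (hK : DifferentiableWithinAt ℝ K (Set.range I) (extChartAt I x y)) :
    MDifferentiableAt I 𝓘(ℝ, ℝ) k y ∧ ∀ v, mvfderiv I k y v
      = fderivWithin ℝ K (Set.range I) (extChartAt I x y)
          (mfderiv I 𝓘(ℝ, E) (extChartAt I x) y v) := by
  have : IsManifold I 1 M := IsManifold.of_le (n := ∞) (by simp)
  have hφ : MDifferentiableWithinAt I 𝓘(ℝ, E) (extChartAt I x) Set.univ y :=
    mdifferentiableWithinAt_univ.2 (mdifferentiableAt_extChartAt hy)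
  have hK' : MDifferentiableWithinAt 𝓘(ℝ, E) 𝓘(ℝ, ℝ) K (Set.range I) (extChartAt I x y) :=
    hK.mdifferentiableWithinAt
  have hsub : Set.univ ⊆ extChartAt I x ⁻¹' Set.range I := fun z _ => by
    simp [extChartAt]
  have h1 := hK'.comp y hφ hsub
  rw [mdifferentiableWithinAt_univ] at h1
  refine ⟨h1.congr_of_eventuallyEq hk, fun v => ?_⟩
  rw [mvfderiv_congr hk]
  have h2 := mvfderivWithin_comp y hK' hφ hsub (uniqueMDiffWithinAt_univ I)
  rw [mvfderivWithin_univ, mfderivWithin_univ] at h2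
  rw [h2]
  simp only [mvfderivWithin, mfderivWithin_eq_fderivWithin]
  rfl

/-- The derivatives of the chart and of its inverse are mutually inverse, so pulling back by the
latter is pushing forward by the former. -/
lemma mpullbackWithin_extChartAt_symm (Z : Π x : M, TangentSpace I x) {x y : M}
    (hy : y ∈ (extChartAt I x).source) :
    mpullbackWithin 𝓘(ℝ, E) I (extChartAt I x).symm Z (Set.range I) (extChartAt I x y)
      = mfderiv I 𝓘(ℝ, E) (extChartAt I x) y (Z y) := by
  have : IsManifold I 1 M := IsManifold.of_le (n := ∞) (by simp)
  have h0 : ∀ y', y' = y → (mfderiv I 𝓘(ℝ, E) (extChartAt I x) y' (Z y') : E)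
      = mfderiv I 𝓘(ℝ, E) (extChartAt I x) y (Z y) := by
    rintro _ rfl; rfl
  rw [mpullbackWithin_apply]
  have hz := (extChartAt I x).map_source hy
  rw [ContinuousLinearMap.inverse_eq (mfderivWithin_extChartAt_symm_comp_mfderiv_extChartAt hz)
    (mfderiv_extChartAt_comp_mfderivWithin_extChartAt_symm hz)]
  exact h0 _ ((extChartAt I x).left_inv hy)

/-- The derivative of a function along the Lie bracket of two vector fields is the commutator of the
derivatives along the vector fields. -/
lemma mvfderiv_mlieBracket [CompleteSpace E] {h : M → ℝ} {X Y : Π x : M, TangentSpace I x} {x : M}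
    (hh : ContMDiffAt I 𝓘(ℝ, ℝ) ∞ h x) (hX : MDiffAt (T% X) x) (hY : MDiffAt (T% Y) x) :
    (∀ Z : Π x : M, TangentSpace I x, MDiffAt (T% Z) x →
      MDifferentiableAt I 𝓘(ℝ, ℝ) (fun y => mvfderiv I h y (Z y)) x) ∧
    mvfderiv I h x (mlieBracket I X Y x)
      = mvfderiv I (fun y => mvfderiv I h y (Y y)) x (X x)
        - mvfderiv I (fun y => mvfderiv I h y (X y)) x (Y x) := by
  have i2 : IsManifold I 2 M := IsManifold.of_le (n := ∞) two_le_infty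
  have i1 : IsManifold I 1 M := IsManifold.of_le (n := ∞) (by simp)
  set φ := extChartAt I x with hφ
  let P : (Π x : M, TangentSpace I x) → E → E := fun Z =>
    mpullbackWithin 𝓘(ℝ, E) I φ.symm Z (Set.range I)
  let h' : E → ℝ := h ∘ φ.symm
  have hxs : x ∈ φ.source := mem_extChartAt_source x
  have hP : ∀ Z : Π x : M, TangentSpace I x, MDiffAt (T% Z) x →
      DifferentiableWithinAt ℝ (P Z) (Set.range I) (φ x) := by
    intro Z hZ
    have := MDifferentiableWithinAt.differentiableWithinAt_mpullbackWithin_vectorField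
      (mdifferentiableWithinAt_univ.2 hZ)
    rwa [Set.preimage_univ, Set.univ_inter] at this
  have hh' : ContDiffWithinAt ℝ ∞ h' (Set.range I) (φ x) := (contMDiffAt_iff.1 hh).2
  have hloc : ∀ y ∈ φ.source, h =ᶠ[𝓝 y] h' ∘ φ := by
    intro y hy
    filter_upwards [extChartAt_source_mem_nhds' (I := I) hy] with z hz
    simp only [h', Function.comp, φ.left_inv hz]
  -- The formula in the chart is needed on a whole neighbourhood of `x`, since it is differentiated
  -- once more.
  have hev : ∀ᶠ y in 𝓝 x, ∀ Z : Π x : M, TangentSpace I x,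
      mvfderiv I h y (Z y) = fderivWithin ℝ h' (Set.range I) (φ y) (P Z (φ y)) := by
    have h1 : ∀ᶠ y in 𝓝 x, ContMDiffAt I 𝓘(ℝ, ℝ) 1 h y :=
      (contMDiffAt_iff_contMDiffAt_nhds (by simp)).1 (hh.of_le (by simp))
    filter_upwards [h1, extChartAt_source_mem_nhds (I := I) x] with y hy hys Z
    have hz : φ y ∈ φ.target := φ.map_source hys
    have hs : φ.symm (φ y) = y := φ.left_inv hys
    have hd : DifferentiableWithinAt ℝ h' (Set.range I) (φ y) := by
      have h2 : MDifferentiableAt I 𝓘(ℝ, ℝ) h (φ.symm (φ y)) := by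
        rw [hs]; exact hy.mdifferentiableAt one_ne_zero
      have h3 : MDifferentiableWithinAt 𝓘(ℝ, E) I φ.symm (Set.range I) (φ y) :=
        (contMDiffWithinAt_extChartAt_symm_range (n := 1) x hz).mdifferentiableWithinAt one_ne_zero
      exact (h2.comp_mdifferentiableWithinAt _ h3).differentiableWithinAt
    rw [(mvfderiv_comp_extChartAt ((extChartAt_source I x) ▸ hys) (hloc y hys) hd).2,
      ← mpullbackWithin_extChartAt_symm Z hys]
  have hPx : ∀ Z : Π x : M, TangentSpace I x, mfderiv I 𝓘(ℝ, E) φ x (Z x) = P Z (φ x) := fun Z =>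
    (mpullbackWithin_extChartAt_symm Z hxs).symm
  have hk : ∀ Z : Π x : M, TangentSpace I x, MDiffAt (T% Z) x →
      MDifferentiableAt I 𝓘(ℝ, ℝ) (fun y => mvfderiv I h y (Z y)) x ∧
      ∀ v, mvfderiv I (fun y => mvfderiv I h y (Z y)) x v =
        fderivWithin ℝ (fun z => fderivWithin ℝ h' (Set.range I) z (P Z z)) (Set.range I) (φ x)
          (mfderiv I 𝓘(ℝ, E) φ x v) := by
    intro Z hZ
    refine mvfderiv_comp_extChartAt (mem_chart_source H x) (hev.mono fun y hy => hy Z) ?_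
    exact ((hh'.fderivWithin_right (m := 1) I.uniqueDiffOn two_le_infty
      (Set.mem_range_self _)).differentiableWithinAt one_ne_zero).clm_apply (hP Z hZ)
  refine ⟨fun Z hZ => (hk Z hZ).1, ?_⟩
  rw [(hk Y hY).2, (hk X hX).2, hPx, hPx]
  have hlie := fderivWithin_apply_lieBracket hh' (by simpa using two_le_infty) I.uniqueDiffOn
    (I.range_subset_closure_interior (Set.mem_range_self _)) (Set.mem_range_self _) (hP Y hY)
    (hP X hX)
  refine Eq.trans ?_ hlie
  rw [(mvfderiv_comp_extChartAt (mem_chart_source H x) (hloc x hxs)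
    (hh'.differentiableWithinAt (by simp))).2]
  congr 1
  rw [← mlieBracketWithin_univ, mlieBracketWithin_apply, Set.preimage_univ, Set.univ_inter]
  exact (isInvertible_mfderiv_extChartAt hxs).self_apply_inverse _

end LieBracket

/-! ### Coordinates in orthonormal frames -/

section Frames

variable {d : ℕ} {M : Type*} [TopologicalSpace M] [ChartedSpace (EuclideanSpace ℝ (Fin d)) M]
  [IsManifold (𝓡 d) ∞ M] (g : SemiRiemannianMetric (𝓡 d) M) {ε : Fin d → ℤˣ} {x : M}
  {e : Fin d → TangentSpace (𝓡 d) x}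

/-- The basis `e` of the tangent space is orthonormal with the signs `ε`. -/
def IsOrthonormalFrame (ε : Fin d → ℤˣ) (e : Fin d → TangentSpace (𝓡 d) x) : Prop :=
  ∀ i j, g.inner x (e i) (e j) = if i = j then ((ε i : ℤ) : ℝ) else 0

/-- The scalar product of coordinate vectors. -/
def scalarProduct (ε : Fin d → ℤˣ) (v w : Fin d → ℝ) : ℝ := ∑ i, ((ε i : ℤ) : ℝ) * (v i * w i)

variable {g} (he : IsOrthonormalFrame g ε e)
include he

lemma IsOrthonormalFrame.coords_sum (c : Fin d → ℝ) : coords g ε e (∑ i, c i • e i) = c := by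
  ext j
  simp only [coords, map_sum, map_smul, sum_apply, smul_apply, he _ j, smul_eq_mul, mul_ite,
    mul_zero, Finset.sum_ite_eq', Finset.mem_univ, if_true]
  linear_combination c j * sign_mul_self (ε j)

lemma IsOrthonormalFrame.coords_self (i : Fin d) : coords g ε e (e i) = Pi.single i 1 := by
  have : ∑ j, (Pi.single i (1 : ℝ) : Fin d → ℝ) j • e j = e i := by
    simp [Pi.single_apply]
  rw [← he.coords_sum (Pi.single i 1), this]

lemma IsOrthonormalFrame.sum_coords (w : TangentSpace (𝓡 d) x) :
    ∑ i, coords g ε e w i • e i = w := by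
  have hli : LinearIndependent ℝ e := by
    rw [Fintype.linearIndependent_iff]
    intro c hc i
    have := he.coords_sum c
    rw [hc] at this
    rw [← this]
    simp [coords]
  have hfin : FiniteDimensional ℝ (TangentSpace (𝓡 d) x) :=
    inferInstanceAs (FiniteDimensional ℝ (EuclideanSpace ℝ (Fin d)))
  have hcard : Fintype.card (Fin d) = Module.finrank ℝ (TangentSpace (𝓡 d) x) := by
    rw [Fintype.card_fin]
    exact finrank_euclideanSpace_fin.symm
  have hspan : w ∈ Submodule.span ℝ (Set.range e) := by
    rw [hli.span_eq_top_of_card_eq_finrank' hcard]; trivial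
  obtain ⟨c, rfl⟩ := (Submodule.mem_span_range_iff_exists_fun ℝ).1 hspan
  rw [he.coords_sum]

lemma IsOrthonormalFrame.inner_eq (v w : TangentSpace (𝓡 d) x) :
    g.inner x v w = scalarProduct ε (coords g ε e v) (coords g ε e w) := by
  conv_lhs => rw [← he.sum_coords w]
  simp only [map_sum, map_smul, smul_eq_mul, scalarProduct]
  refine Finset.sum_congr rfl fun i _ => ?_
  simp only [coords]
  linear_combination (-(((ε i : ℤ) : ℝ) * g.inner x w (e i) * g.inner x v (e i))) *
    sign_mul_self (ε i)

end Frames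

/-! ### The connection form of a local frame -/

section SpinStructure

variable {d : ℕ} {M : Type*} [TopologicalSpace M] [ChartedSpace (EuclideanSpace ℝ (Fin d)) M]
  [IsManifold (𝓡 d) ∞ M] {A : Type*} {g : SemiRiemannianMetric (𝓡 d) M} {ε : Fin d → ℤˣ}
  (σ : SpinStructure A g ε) {a : A} {x : M} (hx : x ∈ σ.dom a)
include hx

lemma SpinStructure.isOrthonormalFrame :
    IsOrthonormalFrame g ε (fun i => σ.frame a i x) := σ.frame_orthonormal hx

lemma SpinStructure.mdiffAt_frame (i : Fin d) : MDifferentiableAt (𝓡 d) (𝓡 d).tangent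
    (fun y => TotalSpace.mk' (EuclideanSpace ℝ (Fin d)) y (σ.frame a i y)) x :=
  ((σ.frame_smooth a i).contMDiffAt ((σ.isOpen_dom a).mem_nhds hx)).mdifferentiableAt (by simp)

omit hx in
/-- The connection form of the Levi-Civita connection with respect to a local frame. -/
def SpinStructure.connectionForm (a : A) {x : M} (v : TangentSpace (𝓡 d) x) (k l : Fin d) : ℝ :=
  g.inner x (g.leviCivita (σ.frame a k) x v) (σ.frame a l x)

/-- The functions `g(s_k, s_l)` are constant near `x`, and the connection is metric. -/
lemma SpinStructure.connectionForm_skew (v : TangentSpace (𝓡 d) x) (k l : Fin d) :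
    σ.connectionForm a v k l = -σ.connectionForm a v l k := by
  obtain ⟨X, hX, rfl⟩ := SemiRiemannianMetric.exists_extension v
  have h := g.leviCivita_metric hX (σ.mdiffAt_frame hx k) (σ.mdiffAt_frame hx l)
  have h0 : (fun y => g.inner y (σ.frame a k y) (σ.frame a l y))
      =ᶠ[𝓝 x] fun _ => if k = l then ((ε k : ℤ) : ℝ) else 0 := by
    filter_upwards [(σ.isOpen_dom a).mem_nhds hx] with y hy using σ.frame_orthonormal hy k l
  rw [mvfderiv_congr h0, mvfderiv_const, zero_apply, g.symm x (σ.frame a k x)] at h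
  simp only [connectionForm]
  linarith

lemma SpinStructure.leviCivita_eq_sum (v : TangentSpace (𝓡 d) x) (k : Fin d) :
    g.leviCivita (σ.frame a k) x v
      = ∑ l, (((ε l : ℤ) : ℝ) * σ.connectionForm a v k l) • σ.frame a l x :=
  ((σ.isOrthonormalFrame hx).sum_coords _).symm

end SpinStructure

/-- Tangent vectors are separated by the derivatives of smooth functions. -/
lemma eq_of_forall_mvfderiv_eq {d : ℕ} {M : Type*} [TopologicalSpace M]
    [ChartedSpace (EuclideanSpace ℝ (Fin d)) M] [IsManifold (𝓡 d) ∞ M] {x : M}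
    {v w : TangentSpace (𝓡 d) x}
    (h : ∀ f : M → ℝ, ContMDiffAt (𝓡 d) 𝓘(ℝ, ℝ) ∞ f x →
      mvfderiv (𝓡 d) f x v = mvfderiv (𝓡 d) f x w) : v = w := by
  have i1 : IsManifold (𝓡 d) 1 M := IsManifold.of_le (n := ∞) (by simp)
  have hφ : ContMDiffAt (𝓡 d) 𝓘(ℝ, EuclideanSpace ℝ (Fin d)) ∞ (extChartAt (𝓡 d) x) x :=
    contMDiffAt_extChartAt
  refine (isInvertible_mfderiv_extChartAt (I := 𝓡 d) (mem_extChartAt_source x)).injective ?_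
  have hw := hasWeakDeriv_mvfderiv (hφ.mdifferentiableAt (by simp))
  have key : mvfderiv (𝓡 d) (extChartAt (𝓡 d) x) x v
      = mvfderiv (𝓡 d) (extChartAt (𝓡 d) x) x w := by
    rw [← sub_eq_zero, ← Module.forall_dual_apply_eq_zero_iff ℝ]
    intro l
    rw [map_sub, sub_eq_zero, ← (hw l).2, ← (hw l).2]
    exact h _ (weaklySmoothAt_iff.2 hφ l)
  exact key

/-! ### The ambient connection along the hypersurface in the adapted frame -/

section Hypersurface

open CliffordAlgebra

variable {n : ℕ} {M F : Type*}
  [TopologicalSpace M] [ChartedSpace (EuclideanSpace ℝ (Fin (n + 1))) M]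
  [IsManifold (𝓡 (n + 1)) ∞ M]
  [TopologicalSpace F] [ChartedSpace (EuclideanSpace ℝ (Fin n)) F] [IsManifold (𝓡 n) ∞ F]
  {gM : SemiRiemannianMetric (𝓡 (n + 1)) M} {gF : SemiRiemannianMetric (𝓡 n) F}
  {ε : Fin (n + 1) → ℤˣ} {p : Fin (n + 1)} {A B : Type*}
  {S : OrientedHypersurface gM gF (ε p)} {σM : SpinStructure A gM ε}
  {σF : SpinStructure B gF (fun i => ε (p.succAbove i))}

lemma OrientedHypersurface.mdifferentiableAt_incl (S : OrientedHypersurface gM gF (ε p)) (y : F) :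
    MDifferentiableAt (𝓡 n) (𝓡 (n + 1)) S.incl y :=
  (S.smooth y).mdifferentiableAt (by simp)

lemma adaptedFrame_self (b : B) (y : F) : adaptedFrame S σF b y p = S.normal y := by
  simp [adaptedFrame]

lemma adaptedFrame_succAbove (b : B) (y : F) (i : Fin n) :
    adaptedFrame S σF b y (p.succAbove i)
      = mfderiv (𝓡 n) (𝓡 (n + 1)) S.incl y (σF.frame b i y) := by
  simp [adaptedFrame]

lemma isOrthonormalFrame_adaptedFrame {b : B} {y : F} (hb : y ∈ σF.dom b) :
    IsOrthonormalFrame gM ε (adaptedFrame S σF b y) := by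
  intro i j
  refine Fin.succAboveCases p ?_ (fun i => ?_) i <;> refine Fin.succAboveCases p ?_ (fun j => ?_) j
  · rw [adaptedFrame_self, S.normal_unit, if_pos rfl]
  · rw [adaptedFrame_self, adaptedFrame_succAbove, S.normal_orthogonal,
      if_neg (Fin.succAbove_ne p j).symm]
  · rw [adaptedFrame_self, adaptedFrame_succAbove, gM.symm, S.normal_orthogonal,
      if_neg (Fin.succAbove_ne p i)]
  · rw [adaptedFrame_succAbove, adaptedFrame_succAbove, S.isometric, σF.frame_orthonormal hb]
    simp only [Fin.succAbove_right_inj]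

variable (S σM σF) in
/-- The coordinates of the adapted frame with respect to a local frame of the ambient manifold. -/
def adaptedCoords (b : B) (a : A) (k : Fin (n + 1)) (y : F) : Fin (n + 1) → ℝ :=
  coords gM ε (fun i => σM.frame a i (S.incl y)) (adaptedFrame S σF b y k)

lemma eventually_mem_dom {b : B} {a : A} {y : F} (hb : y ∈ σF.dom b)
    (ha : S.incl y ∈ σM.dom a) : ∀ᶠ z in 𝓝 y, z ∈ σF.dom b ∧ S.incl z ∈ σM.dom a :=
  Filter.Eventually.and ((σF.isOpen_dom b).mem_nhds hb)
    (S.smooth.continuous.continuousAt.eventually ((σM.isOpen_dom a).mem_nhds ha))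

section Lift

variable (Φ : InducedSpinStructure S σM σF) {b : B} {a : A} {y : F} (hb : y ∈ σF.dom b)
  (ha : S.incl y ∈ σM.dom a)
include hb ha

lemma lift_mul_vec_adaptedCoords (k : Fin (n + 1)) :
    (Φ.lift b a y : Cliff ε) * vec ε (adaptedCoords S σM σF b a k y)
      = basisVec ε k * Φ.lift b a y := by
  rw [adaptedCoords, Φ.lift_frame hb ha, (isOrthonormalFrame_adaptedFrame hb).coords_self]
  rfl

lemma weaklySmoothAt_lift : WeaklySmoothAt (𝓡 n) (fun z => (Φ.lift b a z : Cliff ε)) y := fun l =>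
  (Φ.lift_smooth b a l).contMDiffAt (((σF.isOpen_dom b).inter
    ((σM.isOpen_dom a).preimage S.smooth.continuous)).mem_nhds ⟨hb, ha⟩)

/-- The derivatives of the lift and of the coordinates of the adapted frame. -/
lemma exists_hasWeakDeriv_lift : ∃ (Du : TangentSpace (𝓡 n) y → Cliff ε)
    (Dc : Fin (n + 1) → TangentSpace (𝓡 n) y → (Fin (n + 1) → ℝ)),
    HasWeakDeriv (𝓡 n) (fun z => (Φ.lift b a z : Cliff ε)) y Du ∧
    (∀ k, HasWeakDeriv (𝓡 n) (adaptedCoords S σM σF b a k) y (Dc k)) ∧ ∀ v,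
    involute (Du v) = Du v ∧
    reverse (Du v) * Φ.lift b a y + reverse (Φ.lift b a y : Cliff ε) * Du v = 0 ∧
    ∀ k, Du v * vec ε (adaptedCoords S σM σF b a k y) + Φ.lift b a y * vec ε (Dc k v)
      = basisVec ε k * Du v := by
  have hev := eventually_mem_dom hb ha
  have hsm := weaklySmoothAt_lift Φ hb ha
  set u : F → Cliff ε := fun z => (Φ.lift b a z : Cliff ε) with hu
  obtain ⟨Du, hDu⟩ := hsm.exists_hasWeakDeriv
  obtain ⟨L, hL⟩ := exists_linear_leftInverse_vec ε
  obtain ⟨l₁, hl₁⟩ := exists_dual_one_eq_one ε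
  let μ := LinearMap.mul ℝ (Cliff ε)
  have hrr := (hsm.linear reverse).bilinear hsm μ
  have hrr' := (hDu.linear reverse).bilinear hDu μ
  -- the norm is locally given by the functional `l₁`
  have hnorm : ∀ z, z ∈ σF.dom b ∧ S.incl z ∈ σM.dom a →
      l₁ (reverse (u z) * u z) * l₁ (reverse (u z) * u z) = 1 ∧
      reverse (u z) * u z = algebraMap ℝ _ (l₁ (reverse (u z) * u z)) := by
    rintro z ⟨hz, hz'⟩
    obtain ⟨N, hN, h⟩ := exists_reverse_mul_self_of_mem_spin (Φ.lift_mem hz hz')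
    have : l₁ (reverse (u z) * u z) = N := by
      rw [hu]
      simp only [h, Algebra.algebraMap_eq_smul_one, map_smul, hl₁, smul_eq_mul, mul_one]
    rw [this]
    exact ⟨hN, h⟩
  -- Solve `u c_k = e_k u` for `c_k`: multiply by `reverse u`, use `reverse u * u = N` and `N⁻¹ =
  -- N`. Smoothness of the coordinates thus follows from that of the lift.
  have hc : ∀ k, adaptedCoords S σM σF b a k =ᶠ[𝓝 y] fun z =>
      L (l₁ (reverse (u z) * u z) • (reverse (u z) * (basisVec ε k * u z))) := by
    intro k
    filter_upwards [hev] with z hz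
    have h1 := lift_mul_vec_adaptedCoords Φ hz.1 hz.2 k
    rw [← hL (adaptedCoords S σM σF b a k z)]
    congr 1
    have h2 : reverse (u z) * (basisVec ε k * u z)
        = l₁ (reverse (u z) * u z) • vec ε (adaptedCoords S σM σF b a k z) := by
      rw [← h1, ← mul_assoc, Algebra.smul_def]
      exact congrArg (· * vec ε (adaptedCoords S σM σF b a k z)) (hnorm z hz).2
    rw [h2, smul_smul, (hnorm z hz).1, one_smul]
  have hcs : ∀ k, WeaklySmoothAt (𝓡 n) (adaptedCoords S σM σF b a k) y := fun k =>
    (((hrr.linear l₁).bilinear ((hsm.linear reverse).bilinear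
      (hsm.linear (LinearMap.mulLeft ℝ (basisVec ε k))) μ) (LinearMap.lsmul ℝ (Cliff ε))).linear
        L).congr (hc k)
  choose Dc hDc using fun k => (hcs k).exists_hasWeakDeriv
  refine ⟨Du, Dc, hDu, hDc, fun v => ⟨?_, ?_, fun k => ?_⟩⟩
  · have h1 : (fun z => involute.toLinearMap (u z)) =ᶠ[𝓝 y] u := by
      filter_upwards [hev] with z hz using involute_eq_self_of_mem_spin (Φ.lift_mem hz.1 hz.2)
    exact congrFun ((hDu.linear involute.toLinearMap).unique (hDu.congr h1)) v
  -- Differentiating `N² = 1` gives `2 N N' = 0` with `N ≠ 0`, so the norm `reverse u * u = N` has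
  -- derivative zero.
  · have hN := hrr'.linear l₁
    have hNN := hN.bilinear hN (LinearMap.mul ℝ ℝ)
    have h2 : (fun z => LinearMap.mul ℝ ℝ (l₁ (reverse (u z) * u z)) (l₁ (reverse (u z) * u z)))
        =ᶠ[𝓝 y] fun _ => (1 : ℝ) := by
      filter_upwards [hev] with z hz using (hnorm z hz).1
    have h3 := congrFun (hNN.unique ((HasWeakDeriv.const 1).congr h2)) v
    have h4 : (fun z => reverse (u z) * u z)
        =ᶠ[𝓝 y] fun z => Algebra.linearMap ℝ (Cliff ε) (l₁ (reverse (u z) * u z)) := by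
      filter_upwards [hev] with z hz using (hnorm z hz).2
    have h5 := congrFun (hrr'.unique ((hN.linear (Algebra.linearMap ℝ (Cliff ε))).congr h4)) v
    refine h5.trans ?_
    set δ := l₁ (μ (reverse (Du v)) (u y) + μ (reverse (u y)) (Du v)) with hδ
    have h6 : l₁ (reverse (u y) * u y) ≠ 0 := by
      intro h0
      have := (hnorm y ⟨hb, ha⟩).1
      rw [h0] at this
      norm_num at this
    have h7 : δ * l₁ (reverse (u y) * u y) + l₁ (reverse (u y) * u y) * δ = 0 := h3
    have h8 : δ = 0 := by
      have : δ * l₁ (reverse (u y) * u y) = 0 := by linarith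
      exact (mul_eq_zero.1 this).resolve_right h6
    rw [h8, map_zero]
  · have h1 : (fun z => μ (u z) (vec ε (adaptedCoords S σM σF b a k z)))
        =ᶠ[𝓝 y] fun z => LinearMap.mulLeft ℝ (basisVec ε k) (u z) := by
      filter_upwards [hev] with z hz using lift_mul_vec_adaptedCoords Φ hz.1 hz.2 k
    exact congrFun ((hDu.bilinear ((hDc k).linear (vec ε)) μ).unique
      ((hDu.linear (LinearMap.mulLeft ℝ (basisVec ε k))).congr h1)) v

end Lift

variable {b : B} {a : A} {y : F} (hb : y ∈ σF.dom b) (ha : S.incl y ∈ σM.dom a)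
  {Dc : Fin (n + 1) → TangentSpace (𝓡 n) y → (Fin (n + 1) → ℝ)}
  (hDc : ∀ k, HasWeakDeriv (𝓡 n) (adaptedCoords S σM σF b a k) y (Dc k))

variable (S σM σF b a y Dc) in
/-- The coordinates of the covariant derivative in direction `v` of the vector `k` of the adapted
frame, where `Dc` is the derivative of the coordinates of the adapted frame. -/
def covDerivCoords (k : Fin (n + 1)) (v : TangentSpace (𝓡 n) y) (l : Fin (n + 1)) : ℝ :=
  Dc k v l + ∑ m, adaptedCoords S σM σF b a k y m * (((ε l : ℤ) : ℝ) *
    σM.connectionForm a (mfderiv (𝓡 n) (𝓡 (n + 1)) S.incl y v) m l)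

variable (S σM σF b a y Dc) in
/-- The connection form of the ambient manifold with respect to the adapted frame. -/
def adaptedConnectionForm (v : TangentSpace (𝓡 n) y) (k l : Fin (n + 1)) : ℝ :=
  scalarProduct ε (covDerivCoords S σM σF b a y Dc k v) (adaptedCoords S σM σF b a l y)

include hb ha hDc

/-- The adapted frame stays orthonormal, so the derivatives of its coordinates contribute a skew
part; the ambient connection form contributes another. -/
lemma adaptedConnectionForm_skew (v : TangentSpace (𝓡 n) y) (k l : Fin (n + 1)) :
    adaptedConnectionForm S σM σF b a y Dc v k l
      = -adaptedConnectionForm S σM σF b a y Dc v l k := by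
  let β : (Fin (n + 1) → ℝ) →ₗ[ℝ] (Fin (n + 1) → ℝ) →ₗ[ℝ] ℝ :=
    LinearMap.mk₂ ℝ (scalarProduct ε)
      (fun u v w => by simp [scalarProduct, add_mul, mul_add, Finset.sum_add_distrib])
      (fun c u v => by simp [scalarProduct, Finset.mul_sum]; simp only [mul_left_comm, mul_assoc])
      (fun u v w => by simp [scalarProduct, mul_add, Finset.sum_add_distrib])
      (fun c u v => by simp [scalarProduct, Finset.mul_sum]; simp only [mul_left_comm])
  have h1 : (fun z => β (adaptedCoords S σM σF b a k z) (adaptedCoords S σM σF b a l z))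
      =ᶠ[𝓝 y] fun _ => if k = l then ((ε k : ℤ) : ℝ) else 0 := by
    filter_upwards [eventually_mem_dom hb ha] with z hz
    rw [← isOrthonormalFrame_adaptedFrame (S := S) hz.1 k l,
      (σM.isOrthonormalFrame hz.2).inner_eq]
    rfl
  have h2 : scalarProduct ε (Dc k v) (adaptedCoords S σM σF b a l y)
      + scalarProduct ε (adaptedCoords S σM σF b a k y) (Dc l v) = 0 :=
    congrFun (((hDc k).bilinear (hDc l) β).unique ((HasWeakDeriv.const _).congr h1)) v
  set w := mfderiv (𝓡 n) (𝓡 (n + 1)) S.incl y v with hw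
  have h3 : ∀ i j, adaptedConnectionForm S σM σF b a y Dc v i j
      = scalarProduct ε (Dc i v) (adaptedCoords S σM σF b a j y)
        + ∑ m, ∑ r, adaptedCoords S σM σF b a i y m * adaptedCoords S σM σF b a j y r *
            σM.connectionForm a w m r := by
    intro i j
    rw [Finset.sum_comm]
    simp only [adaptedConnectionForm, covDerivCoords, scalarProduct, ← hw, add_mul, mul_add,
      Finset.sum_add_distrib, Finset.sum_mul, Finset.mul_sum]
    congr 1
    refine Finset.sum_congr rfl fun r _ => Finset.sum_congr rfl fun m _ => ?_
    linear_combination (adaptedCoords S σM σF b a i y m * adaptedCoords S σM σF b a j y r *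
            σM.connectionForm a w m r) * sign_mul_self (ε r)
  have h4 : ∑ m, ∑ r, adaptedCoords S σM σF b a l y m * adaptedCoords S σM σF b a k y r *
            σM.connectionForm a w m r
      = -∑ m, ∑ r, adaptedCoords S σM σF b a k y m * adaptedCoords S σM σF b a l y r *
            σM.connectionForm a w m r := by
    rw [Finset.sum_comm, ← Finset.sum_neg_distrib]
    refine Finset.sum_congr rfl fun m _ => ?_
    rw [← Finset.sum_neg_distrib]
    refine Finset.sum_congr rfl fun r _ => ?_
    rw [σM.connectionForm_skew ha w r m]
    ring
  have h5 : scalarProduct ε (Dc l v) (adaptedCoords S σM σF b a k y)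
      = scalarProduct ε (adaptedCoords S σM σF b a k y) (Dc l v) :=
    Finset.sum_congr rfl fun i _ => by ring
  rw [h3, h3, h4, h5]
  linarith

-- Metric compatibility applied to an extension `N` of the normal field: the covariant derivative of
-- the normal along `F` is that of `N`, which umbilicity makes `c` times the direction.
omit hb in
lemma adaptedConnectionForm_normal {c : F → ℝ} {N : Π x : M, TangentSpace (𝓡 (n + 1)) x}
    (hN : MDifferentiableAt (𝓡 (n + 1)) (𝓡 (n + 1)).tangent
      (fun x => TotalSpace.mk' (EuclideanSpace ℝ (Fin (n + 1))) x (N x)) (S.incl y))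
    (hNS : ∀ᶠ z in 𝓝 y, N (S.incl z) = S.normal z)
    (hc : ∀ X : TangentSpace (𝓡 n) y,
      gM.leviCivita N (S.incl y) (mfderiv (𝓡 n) (𝓡 (n + 1)) S.incl y X)
        = c y • mfderiv (𝓡 n) (𝓡 (n + 1)) S.incl y X) (v : TangentSpace (𝓡 n) y)
    (l : Fin (n + 1)) :
    adaptedConnectionForm S σM σF b a y Dc v p l
      = c y * gM.inner (S.incl y) (mfderiv (𝓡 n) (𝓡 (n + 1)) S.incl y v)
        (adaptedFrame S σF b y l) := by
  have hcp : ∀ i, (fun z => adaptedCoords S σM σF b a p z i) =ᶠ[𝓝 y] fun z =>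
      LinearMap.mulLeft ℝ ((ε i : ℤ) : ℝ)
        (gM.inner (S.incl z) (N (S.incl z)) (σM.frame a i (S.incl z))) := by
    intro i
    filter_upwards [hNS] with z hz
    simp only [adaptedCoords, adaptedFrame_self, hz, coords, LinearMap.mulLeft_apply]
  set w := mfderiv (𝓡 n) (𝓡 (n + 1)) S.incl y v with hw
  have hDcp : ∀ i, Dc p v i = ((ε i : ℤ) : ℝ) *
      (c y * gM.inner (S.incl y) w (σM.frame a i (S.incl y))
        + gM.inner (S.incl y) (N (S.incl y)) (gM.leviCivita (σM.frame a i) (S.incl y) w)) := by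
    intro i
    have hd := gM.mdifferentiableAt_inner hN (σM.mdiffAt_frame ha i)
    have h1 := ((HasWeakDeriv.real hd).comp (S.mdifferentiableAt_incl y)).linear
      (LinearMap.mulLeft ℝ ((ε i : ℤ) : ℝ))
    have h2 := congrFun (((hDc p).linear (LinearMap.proj i)).unique (h1.congr (hcp i))) v
    refine h2.trans (congrArg (fun t => ((ε i : ℤ) : ℝ) * t) ?_)
    obtain ⟨X, hX, hXw⟩ := SemiRiemannianMetric.exists_extension w
    have h3 := gM.leviCivita_metric hX hN (σM.mdiffAt_frame ha i)
    rw [hXw, hw, hc, ← hw, map_smul, smul_apply, smul_eq_mul] at h3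
    exact h3
  have hq : ∀ i, covDerivCoords S σM σF b a y Dc p v i
      = c y * coords gM ε (fun i => σM.frame a i (S.incl y)) w i := by
    intro i
    -- By skewness of the connection form, this part of `Dc p v i` cancels the connection term in
    -- `covDerivCoords`.
    have h1 : gM.inner (S.incl y) (N (S.incl y)) (gM.leviCivita (σM.frame a i) (S.incl y) w)
        = -∑ m, adaptedCoords S σM σF b a p y m * σM.connectionForm a w m i := by
      rw [σM.leviCivita_eq_sum ha, map_sum, ← Finset.sum_neg_distrib]
      refine Finset.sum_congr rfl fun m _ => ?_
      have h2 := (hcp m).eq_of_nhds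
      simp only [LinearMap.mulLeft_apply] at h2
      rw [h2, map_smul, smul_eq_mul, σM.connectionForm_skew ha w i m]
      ring
    have h2 : ∑ m, adaptedCoords S σM σF b a p y m * (((ε i : ℤ) : ℝ) * σM.connectionForm a w m i)
        = ((ε i : ℤ) : ℝ) * ∑ m, adaptedCoords S σM σF b a p y m * σM.connectionForm a w m i := by
      rw [Finset.mul_sum]
      exact Finset.sum_congr rfl fun m _ => by ring
    rw [covDerivCoords, ← hw, hDcp, h1, h2, coords]
    ring
  rw [(σM.isOrthonormalFrame ha).inner_eq, adaptedConnectionForm]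
  simp only [scalarProduct, hq, adaptedCoords, Finset.mul_sum]
  exact Finset.sum_congr rfl fun i _ => by ring

/-- The induced connection is torsion-free. -/
lemma covDerivCoords_sub (j k : Fin n) :
    covDerivCoords S σM σF b a y Dc (p.succAbove k) (σF.frame b j y)
      - covDerivCoords S σM σF b a y Dc (p.succAbove j) (σF.frame b k y)
      = coords gM ε (fun i => σM.frame a i (S.incl y)) (mfderiv (𝓡 n) (𝓡 (n + 1)) S.incl y
          (mlieBracket (𝓡 n) (σF.frame b j) (σF.frame b k) y)) := by
  set s : Fin (n + 1) → TangentSpace (𝓡 (n + 1)) (S.incl y) := fun i => σM.frame a i (S.incl y)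
    with hs
  have hframe : ∀ z, S.incl z ∈ σM.dom a → ∀ i, mfderiv (𝓡 n) (𝓡 (n + 1)) S.incl z (σF.frame b i z)
      = ∑ m, adaptedCoords S σM σF b a (p.succAbove i) z m • σM.frame a m (S.incl z) := by
    intro z hz i
    rw [← adaptedFrame_succAbove]
    exact ((σM.isOrthonormalFrame hz).sum_coords _).symm
  suffices h : mfderiv (𝓡 n) (𝓡 (n + 1)) S.incl y
      (mlieBracket (𝓡 n) (σF.frame b j) (σF.frame b k) y)
      = ∑ i, (covDerivCoords S σM σF b a y Dc (p.succAbove k) (σF.frame b j y)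
        - covDerivCoords S σM σF b a y Dc (p.succAbove j) (σF.frame b k y)) i • s i by
    rw [h, (σM.isOrthonormalFrame ha).coords_sum]
  -- Testing on functions avoids extending the frame of `F` to `M`: the bracket on `F` acts on `h ∘
  -- S.incl` as a commutator, and second derivatives are expanded in the ambient frame.
  refine eq_of_forall_mvfderiv_eq fun h hh => ?_
  -- the derivatives of `h` along the frames
  have hhF : ContMDiffAt (𝓡 n) 𝓘(ℝ, ℝ) ∞ (h ∘ S.incl) y := hh.comp y (S.smooth y)
  let hm : Fin (n + 1) → M → ℝ := fun m x => mvfderiv (𝓡 (n + 1)) h x (σM.frame a m x)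
  have hmd : ∀ m, MDifferentiableAt (𝓡 (n + 1)) 𝓘(ℝ, ℝ) (hm m) (S.incl y) := fun m =>
    (mvfderiv_mlieBracket hh (σM.mdiffAt_frame ha m) (σM.mdiffAt_frame ha m)).1 _
      (σM.mdiffAt_frame ha m)
  have hsnd : ∀ i v, mvfderiv (𝓡 n) (fun z => mvfderiv (𝓡 n) (h ∘ S.incl) z (σF.frame b i z)) y v
      = ∑ m, (Dc (p.succAbove i) v m * hm m (S.incl y)
        + adaptedCoords S σM σF b a (p.succAbove i) y m
          * mvfderiv (𝓡 (n + 1)) (hm m) (S.incl y) (mfderiv (𝓡 n) (𝓡 (n + 1)) S.incl y v)) := by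
    intro i v
    have h1 : (fun z => mvfderiv (𝓡 n) (h ∘ S.incl) z (σF.frame b i z)) =ᶠ[𝓝 y] fun z =>
        ∑ m, adaptedCoords S σM σF b a (p.succAbove i) z m * hm m (S.incl z) := by
      have h2 : ∀ᶠ x in 𝓝 (S.incl y), ContMDiffAt (𝓡 (n + 1)) 𝓘(ℝ, ℝ) 1 h x :=
        (contMDiffAt_iff_contMDiffAt_nhds (by simp)).1 (hh.of_le (by simp))
      filter_upwards [eventually_mem_dom hb ha,
        S.smooth.continuous.continuousAt.eventually h2] with z hz hz2
      refine (mvfderiv_comp_apply z (hz2.mdifferentiableAt one_ne_zero)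
        (S.mdifferentiableAt_incl z) _).trans ?_
      rw [hframe z hz.2, map_sum]
      exact Finset.sum_congr rfl fun m _ => by rw [map_smul, smul_eq_mul]
    have h3 : ∀ m, HasWeakDeriv (𝓡 n)
        (fun z => adaptedCoords S σM σF b a (p.succAbove i) z m * hm m (S.incl z)) y
        (fun v => Dc (p.succAbove i) v m * hm m (S.incl y)
          + adaptedCoords S σM σF b a (p.succAbove i) y m
            * mvfderiv (𝓡 (n + 1)) (hm m) (S.incl y)
              (mfderiv (𝓡 n) (𝓡 (n + 1)) S.incl y v)) := fun m =>
      ((hDc (p.succAbove i)).linear (LinearMap.proj m)).bilinear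
        ((HasWeakDeriv.real (hmd m)).comp (S.mdifferentiableAt_incl y)) (LinearMap.mul ℝ ℝ)
    rw [mvfderiv_congr h1, (mvfderiv_sum Finset.univ fun m _ => (h3 m).mdifferentiableAt).2,
      sum_apply]
    exact Finset.sum_congr rfl fun m _ => (h3 m).mvfderiv_eq v
  -- Torsion-freeness on `M`: after antisymmetrization, second derivatives of `h` along the frame
  -- agree with derivatives along the covariant derivatives of the frame.
  have hbr : ∀ i m, mvfderiv (𝓡 (n + 1)) h (S.incl y)
      (gM.leviCivita (σM.frame a m) (S.incl y) (s i))
      - mvfderiv (𝓡 (n + 1)) h (S.incl y) (gM.leviCivita (σM.frame a i) (S.incl y) (s m))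
      = mvfderiv (𝓡 (n + 1)) (hm m) (S.incl y) (s i)
        - mvfderiv (𝓡 (n + 1)) (hm i) (S.incl y) (s m) := by
    intro i m
    rw [← map_sub, gM.leviCivita_torsion (σM.mdiffAt_frame ha i) (σM.mdiffAt_frame ha m)]
    exact (mvfderiv_mlieBracket hh (σM.mdiffAt_frame ha i) (σM.mdiffAt_frame ha m)).2
  have hcov : ∀ i v, ∑ l, covDerivCoords S σM σF b a y Dc i v l * hm l (S.incl y)
      = ∑ l, Dc i v l * hm l (S.incl y) + ∑ m, adaptedCoords S σM σF b a i y m *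
        mvfderiv (𝓡 (n + 1)) h (S.incl y) (gM.leviCivita (σM.frame a m) (S.incl y)
          (mfderiv (𝓡 n) (𝓡 (n + 1)) S.incl y v)) := by
    intro i v
    simp only [σM.leviCivita_eq_sum ha, covDerivCoords, add_mul, Finset.sum_add_distrib, map_sum,
      map_smul, smul_eq_mul, Finset.sum_mul, Finset.mul_sum]
    congr 1
    rw [Finset.sum_comm]
    exact Finset.sum_congr rfl fun _ _ => Finset.sum_congr rfl fun _ _ => mul_assoc _ _ _
  have hlhs : mvfderiv (𝓡 (n + 1)) h (S.incl y) (mfderiv (𝓡 n) (𝓡 (n + 1)) S.incl y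
      (mlieBracket (𝓡 n) (σF.frame b j) (σF.frame b k) y))
      = mvfderiv (𝓡 n) (h ∘ S.incl) y (mlieBracket (𝓡 n) (σF.frame b j) (σF.frame b k) y) :=
    (mvfderiv_comp_apply y (hh.mdifferentiableAt (by simp)) (S.mdifferentiableAt_incl y) _).symm
  rw [hlhs, (mvfderiv_mlieBracket hhF (σF.mdiffAt_frame hb j) (σF.mdiffAt_frame hb k)).2, hsnd,
    hsnd]
  have hrhs : mvfderiv (𝓡 (n + 1)) h (S.incl y)
      (∑ i, (covDerivCoords S σM σF b a y Dc (p.succAbove k) (σF.frame b j y)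
        - covDerivCoords S σM σF b a y Dc (p.succAbove j) (σF.frame b k y)) i • s i)
      = ∑ l, covDerivCoords S σM σF b a y Dc (p.succAbove k) (σF.frame b j y) l * hm l (S.incl y)
        - ∑ l, covDerivCoords S σM σF b a y Dc (p.succAbove j) (σF.frame b k y) l
          * hm l (S.incl y) := by
    rw [map_sum, ← Finset.sum_sub_distrib]
    refine Finset.sum_congr rfl fun l _ => ?_
    rw [map_smul, smul_eq_mul, Pi.sub_apply, sub_mul]
  rw [hrhs, hcov, hcov, hframe y ha j, hframe y ha k]
  simp only [Finset.sum_add_distrib, map_sum, map_smul, smul_eq_mul, Finset.mul_sum]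
  have hfin : ∀ T : Fin (n + 1) → Fin (n + 1) → ℝ,
      ∑ m, ∑ i, adaptedCoords S σM σF b a (p.succAbove j) y m
        * (adaptedCoords S σM σF b a (p.succAbove k) y i * T m i)
      = ∑ m, ∑ i, adaptedCoords S σM σF b a (p.succAbove k) y m
        * (adaptedCoords S σM σF b a (p.succAbove j) y i * T i m) := by
    intro T
    rw [Finset.sum_comm]
    exact Finset.sum_congr rfl fun _ _ => Finset.sum_congr rfl fun _ _ => by ring
  have h1 := hfin fun m i => mvfderiv (𝓡 (n + 1)) (hm m) (S.incl y) (s i)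
  have h2 := hfin fun m i => mvfderiv (𝓡 (n + 1)) h (S.incl y)
    (gM.leviCivita (σM.frame a m) (S.incl y) (s i))
  have h3 : ∑ m, ∑ i, adaptedCoords S σM σF b a (p.succAbove k) y m
        * (adaptedCoords S σM σF b a (p.succAbove j) y i
          * mvfderiv (𝓡 (n + 1)) (hm m) (S.incl y) (s i))
      - ∑ m, ∑ i, adaptedCoords S σM σF b a (p.succAbove k) y m
        * (adaptedCoords S σM σF b a (p.succAbove j) y i
          * mvfderiv (𝓡 (n + 1)) (hm i) (S.incl y) (s m))
      = ∑ m, ∑ i, adaptedCoords S σM σF b a (p.succAbove k) y m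
        * (adaptedCoords S σM σF b a (p.succAbove j) y i * mvfderiv (𝓡 (n + 1)) h (S.incl y)
          (gM.leviCivita (σM.frame a m) (S.incl y) (s i)))
      - ∑ m, ∑ i, adaptedCoords S σM σF b a (p.succAbove k) y m
        * (adaptedCoords S σM σF b a (p.succAbove j) y i * mvfderiv (𝓡 (n + 1)) h (S.incl y)
          (gM.leviCivita (σM.frame a i) (S.incl y) (s m))) := by
    simp only [← Finset.sum_sub_distrib, ← mul_sub, hbr]
  linarith

/-- The Gauss formula. -/
lemma adaptedConnectionForm_tangential (j k l : Fin n) :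
    adaptedConnectionForm S σM σF b a y Dc (σF.frame b j y) (p.succAbove k) (p.succAbove l)
      = σF.connectionForm b (σF.frame b j y) k l := by
  let T : Fin n → Fin n → Fin n → ℝ := fun j k l =>
    adaptedConnectionForm S σM σF b a y Dc (σF.frame b j y) (p.succAbove k) (p.succAbove l)
      - σF.connectionForm b (σF.frame b j y) k l
  have hskew : ∀ j k l, T j k l = -T j l k := by
    intro j k l
    simp only [T]
    rw [adaptedConnectionForm_skew hb ha hDc, σF.connectionForm_skew hb]
    ring
  have hsymm : ∀ j k l, T j k l = T k j l := by
    intro j k l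
    have h1 : adaptedConnectionForm S σM σF b a y Dc (σF.frame b j y) (p.succAbove k) (p.succAbove l)
        - adaptedConnectionForm S σM σF b a y Dc (σF.frame b k y) (p.succAbove j) (p.succAbove l)
        = gF.inner y (mlieBracket (𝓡 n) (σF.frame b j) (σF.frame b k) y) (σF.frame b l y) := by
      rw [← S.isometric, (σM.isOrthonormalFrame ha).inner_eq, ← covDerivCoords_sub hb ha hDc,
        ← adaptedFrame_succAbove]
      simp only [adaptedConnectionForm, scalarProduct, Pi.sub_apply, ← Finset.sum_sub_distrib,
        adaptedCoords]
      exact Finset.sum_congr rfl fun i _ => by ring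
    have h2 : σF.connectionForm b (σF.frame b j y) k l - σF.connectionForm b (σF.frame b k y) j l
        = gF.inner y (mlieBracket (𝓡 n) (σF.frame b j) (σF.frame b k) y) (σF.frame b l y) := by
      rw [← gF.leviCivita_torsion (σF.mdiffAt_frame hb j) (σF.mdiffAt_frame hb k), map_sub,
        sub_apply]
      rfl
    simp only [T]
    linarith
  -- A tensor symmetric in the first two indices and skew in the last two vanishes: `T_jkl = T_kjl =
  -- -T_klj = -T_lkj = T_ljk = T_jlk = -T_jkl`.
  have : T j k l = 0 := by
    linarith [hsymm j k l, hskew k j l, hsymm k l j, hskew l k j, hsymm l j k, hskew j l k]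
  exact sub_eq_zero.1 this

end Hypersurface

/-! ### The twistor equation in a gauge -/

section Twistor

variable {d : ℕ} {M : Type*} [TopologicalSpace M] [ChartedSpace (EuclideanSpace ℝ (Fin d)) M]
  [IsManifold (𝓡 d) ∞ M] {A : Type*} {g : SemiRiemannianMetric (𝓡 d) M} {ε : Fin d → ℤˣ}
  (σ : SpinStructure A g ε)
  {Δ : Type*} [NormedAddCommGroup Δ] [NormedSpace ℂ Δ] (ρ : SpinorModule ε Δ)

lemma spinorDeriv_eq (φ : A → M → Δ) (a : A) {x : M} (v : TangentSpace (𝓡 d) x) :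
    spinorDeriv σ ρ φ a v
      = mvfderiv (𝓡 d) (φ a) x v + ρ.act (bivector ε (σ.connectionForm a v)) (φ a x) := by
  simp only [spinorDeriv, bivector, map_smul, map_sum, LinearMap.smul_apply, LinearMap.sum_apply]
  rfl

lemma isLinearMap_spinorDeriv (φ : A → M → Δ) (a : A) (x : M) :
    IsLinearMap ℝ (fun v : TangentSpace (𝓡 d) x => spinorDeriv σ ρ φ a v) where
  map_add v w := by
    simp only [spinorDeriv, map_add, add_apply, mul_add, add_smul, Finset.sum_add_distrib, smul_add]
    abel
  map_smul c v := by
    simp only [spinorDeriv, map_smul, smul_apply, smul_eq_mul, smul_add, Finset.smul_sum, smul_smul]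
    congr 1
    refine Finset.sum_congr rfl fun k _ => Finset.sum_congr rfl fun l _ => ?_
    congr 1; ring

variable {σ ρ} {φ : A → M → Δ} {a : A} {x : M} (hx : x ∈ σ.dom a)
include hx

lemma cliffMul_frame (i : Fin d) (w : Δ) :
    cliffMul σ ρ a (σ.frame a i x) w = ρ.act (basisVec ε i) w := by
  rw [cliffMul, (σ.isOrthonormalFrame hx).coords_self]
  rfl

/-- The twistor equation `∇_v φ = -(1 / d) v · D φ`. -/
lemma spinorDeriv_eq_of_twistorOperator_eq_zero (h : twistorOperator σ ρ φ a x = 0)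
    (v : TangentSpace (𝓡 d) x) :
    spinorDeriv σ ρ φ a v = -((1 / (d : ℝ)) • cliffMul σ ρ a v (dirac σ ρ φ a x)) := by
  have hk : ∀ k, spinorDeriv σ ρ φ a (σ.frame a k x)
      = -((1 / (d : ℝ)) • ρ.act (basisVec ε k) (dirac σ ρ φ a x)) := by
    intro k
    -- Contracting the tensor with `s_k` isolates its `k`-th component, since the frame is
    -- orthonormal.
    let T : TangentSpace (𝓡 d) x ⊗[ℝ] Δ →ₗ[ℝ] Δ := TensorProduct.lift
      (LinearMap.mk₂ ℝ (fun w ψ => g.inner x w (σ.frame a k x) • ψ)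
        (fun _ _ _ => by simp [add_smul]) (fun _ _ _ => by simp [mul_smul])
        (fun _ _ _ => by simp) (fun _ _ _ => by rw [smul_comm]))
    have h1 := congrArg T h
    rw [twistorOperator, map_sum, map_zero, Finset.sum_eq_single k] at h1
    · rw [map_smul, TensorProduct.lift.tmul, LinearMap.mk₂_apply, σ.frame_orthonormal hx, if_pos rfl,
        smul_smul, sign_mul_self, one_smul, cliffMul_frame hx] at h1
      exact eq_neg_of_add_eq_zero_left h1
    · intro j _ hj
      rw [map_smul, TensorProduct.lift.tmul, LinearMap.mk₂_apply, σ.frame_orthonormal hx, if_neg hj,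
        zero_smul, smul_zero]
    · simp
  have h2 := map_sum (isLinearMap_spinorDeriv σ ρ φ a x).mk'
    (fun i => coords g ε (fun i => σ.frame a i x) v i • σ.frame a i x) Finset.univ
  rw [(σ.isOrthonormalFrame hx).sum_coords] at h2
  refine h2.trans ?_
  rw [cliffMul, vec_eq_sum, map_sum, LinearMap.sum_apply, Finset.smul_sum, ← Finset.sum_neg_distrib]
  refine Finset.sum_congr rfl fun i _ => ?_
  rw [map_smul, IsLinearMap.mk'_apply, hk, map_smul, LinearMap.smul_apply, smul_neg, smul_comm]

/-- A spinor field with `∇_v φ = v · χ` solves the twistor equation. -/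
lemma twistorOperator_eq_zero_of_spinorDeriv_eq (χ : Δ)
    (h : ∀ j, spinorDeriv σ ρ φ a (σ.frame a j x) = ρ.act (basisVec ε j) χ) :
    twistorOperator σ ρ φ a x = 0 := by
  -- Each of the `d` summands is `ε_j e_j e_j χ = -χ`.
  have hD : dirac σ ρ φ a x = -((d : ℝ) • χ) := by
    have h1 : ∀ j, ((ε j : ℤ) : ℝ) • cliffMul σ ρ a (σ.frame a j x)
        (spinorDeriv σ ρ φ a (σ.frame a j x)) = (-1 : ℝ) • χ := by
      intro j
      rw [h, cliffMul_frame hx, ← Module.End.mul_apply, ← map_mul, basisVec_mul_self,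
        AlgHom.commutes, Module.algebraMap_end_apply, smul_smul, mul_neg, sign_mul_self]
    rw [dirac, Finset.sum_congr rfl fun j _ => h1 j]
    simp [Nat.cast_smul_eq_nsmul]
  refine Finset.sum_eq_zero fun j _ => ?_
  -- An index `j` exists, so `d` is positive; for `d = 0` the sum is empty and the default value of
  -- `1 / 0` plays no role.
  have hd : (d : ℝ) ≠ 0 := by
    have := j.pos
    positivity
  rw [h, hD, cliffMul_frame hx, map_neg, LinearMap.map_smul_of_tower, smul_neg, smul_smul,
    one_div_mul_cancel hd, one_smul, add_neg_cancel, TensorProduct.tmul_zero, smul_zero]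

end Twistor

/-! ### The Clifford algebra of the hyperplane -/

section HyperplaneAlgebra

open CliffordAlgebra

variable {n : ℕ} {ε : Fin (n + 1) → ℤˣ} {p : Fin (n + 1)}

lemma hyperplane_single (j : Fin n) :
    hyperplane ε p (Pi.single j 1) = Pi.single (p.succAbove j) 1 := by
  change p.insertNth (α := fun _ => ℝ) 0 (Pi.single j 1) = _
  ext i
  refine Fin.succAboveCases p ?_ (fun k => ?_) i
  · simp [(Fin.succAbove_ne p j).symm]
  · simp [Pi.single_apply]

lemma map_hyperplane_basisVec (j : Fin n) :
    CliffordAlgebra.map (hyperplane ε p) (basisVec (fun i => ε (p.succAbove i)) j)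
      = basisVec ε (p.succAbove j) := by
  rw [basisVec, map_apply_ι, hyperplane_single]
  rfl

/-- Split the sum at the index `p`. In the mixed terms `e_p` is moved to the right, at the cost of a
sign, so that the tangential factor stands on the left, where it can be carried through the
identification of spinors. -/
lemma bivector_eq_map_hyperplane_add {Γ : Fin (n + 1) → Fin (n + 1) → ℝ}
    (hΓ : ∀ k l, Γ k l = -Γ l k) :
    bivector ε Γ = CliffordAlgebra.map (hyperplane ε p)
        (bivector (fun i => ε (p.succAbove i)) (fun k l => Γ (p.succAbove k) (p.succAbove l)))
      - (1 / 2 : ℝ) • ∑ j, (((ε p : ℤ) : ℝ) * ((ε (p.succAbove j) : ℤ) : ℝ) * Γ p (p.succAbove j)) •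
          (basisVec ε (p.succAbove j) * basisVec ε p) := by
  have hpp : Γ p p = 0 := by linarith [hΓ p p]
  have hsw : ∀ j, basisVec ε p * basisVec ε (p.succAbove j)
      = -(basisVec ε (p.succAbove j) * basisVec ε p) := by
    intro j
    have := basisVec_mul_basisVec_add_swap ε p (p.succAbove j)
    rw [if_neg (Fin.succAbove_ne p j).symm, map_zero] at this
    exact eq_neg_of_add_eq_zero_left this
  rw [bivector_eq_sum hΓ, bivector_eq_sum fun k l => hΓ _ _]
  simp only [map_smul, map_sum, map_mul, map_hyperplane_basisVec]
  rw [Fin.sum_univ_succAbove _ p, Fin.sum_univ_succAbove _ p, hpp]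
  simp only [Fin.sum_univ_succAbove _ p, Finset.sum_add_distrib, hsw]
  have h1 : ∀ j, (((ε (p.succAbove j) : ℤ) : ℝ) * ((ε p : ℤ) : ℝ) * Γ (p.succAbove j) p) •
        (basisVec ε (p.succAbove j) * basisVec ε p)
      = -((((ε p : ℤ) : ℝ) * ((ε (p.succAbove j) : ℤ) : ℝ) * Γ p (p.succAbove j)) •
        (basisVec ε (p.succAbove j) * basisVec ε p)) := by
    intro j
    rw [hΓ (p.succAbove j) p, ← neg_smul]
    congr 1; ring
  simp only [h1, smul_neg, Finset.sum_neg_distrib, mul_zero, zero_smul, zero_add]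
  module

/-- Vectors generate the Clifford algebra, so commutation with vectors of the hyperplane extends to
its whole algebra, in particular to bivectors and to the spin group. -/
lemma SpinorIdentification.map_act {ΔM ΔF : Type*} [AddCommGroup ΔM] [Module ℂ ΔM]
    [AddCommGroup ΔF] [Module ℂ ΔF] {ρM : SpinorModule ε ΔM}
    {ρF : SpinorModule (fun i => ε (p.succAbove i)) ΔF} (r : SpinorIdentification p ρM ρF)
    (x : Cliff (fun i => ε (p.succAbove i))) (w : ΔM) :
    r.toLin (ρM.act (CliffordAlgebra.map (hyperplane ε p) x) w) = ρF.act x (r.toLin w) := by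
  induction x using CliffordAlgebra.induction generalizing w with
  | algebraMap c =>
    rw [AlgHom.commutes, AlgHom.commutes, AlgHom.commutes, Module.algebraMap_end_apply,
      Module.algebraMap_end_apply, LinearMap.map_smul_of_tower]
  | ι v => rw [map_apply_ι]; exact r.map_vec v w
  | mul x y hx hy =>
    rw [map_mul, map_mul, map_mul, Module.End.mul_apply, hx, hy, Module.End.mul_apply]
  | add x y hx hy =>
    rw [map_add, map_add, map_add, LinearMap.add_apply, map_add, hx, hy, LinearMap.add_apply]

end HyperplaneAlgebra

/-! ### The spinorial Gauss formula -/

section Restriction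

open CliffordAlgebra

variable {n : ℕ} {M F : Type*}
  [TopologicalSpace M] [ChartedSpace (EuclideanSpace ℝ (Fin (n + 1))) M]
  [IsManifold (𝓡 (n + 1)) ∞ M]
  [TopologicalSpace F] [ChartedSpace (EuclideanSpace ℝ (Fin n)) F] [IsManifold (𝓡 n) ∞ F]
  {gM : SemiRiemannianMetric (𝓡 (n + 1)) M} {gF : SemiRiemannianMetric (𝓡 n) F}
  {ε : Fin (n + 1) → ℤˣ} {p : Fin (n + 1)} {A B : Type*}
  {S : OrientedHypersurface gM gF (ε p)} {σM : SpinStructure A gM ε}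
  {σF : SpinStructure B gF (fun i => ε (p.succAbove i))} (Φ : InducedSpinStructure S σM σF)
  {ΔM ΔF : Type*} [NormedAddCommGroup ΔM] [NormedSpace ℂ ΔM]
  [NormedAddCommGroup ΔF] [NormedSpace ℂ ΔF]
  {ρM : SpinorModule ε ΔM} {ρF : SpinorModule (fun i => ε (p.succAbove i)) ΔF}
  (r : SpinorIdentification p ρM ρF) {φ : A → M → ΔM}

/-- The Clifford action on the spinors of the ambient space, seen as spinors of the hyperplane. -/
def SpinorIdentification.actLin (r : SpinorIdentification p ρM ρF) :
    Cliff ε →ₗ[ℝ] ΔM →ₗ[ℝ] ΔF :=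
  LinearMap.mk₂ ℝ (fun x w => r.toLin (ρM.act x w)) (fun _ _ _ => by simp)
    (fun _ _ _ => by simp [LinearMap.map_smul_of_tower]) (fun _ _ _ => by simp)
    (fun _ _ _ => by simp [LinearMap.map_smul_of_tower])

/-- The restriction of a spinor field does not depend on the gauge. -/
lemma restrict_eq (hφ : IsSpinorField σM ρM φ) {b : B} {a : A} {y : F} (hb : y ∈ σF.dom b)
    (ha : S.incl y ∈ σM.dom a) :
    restrict Φ r φ b y = r.toLin (ρM.act (Φ.lift b a y : Cliff ε) (φ a (S.incl y))) := by
  have h0 := Classical.choose_spec (σM.exists_mem_dom (S.incl y))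
  rw [restrict, hφ.compat h0 ha, ← Module.End.mul_apply, ← map_mul, ← Units.val_mul,
    Φ.lift_trans hb h0 ha]

/-- The gauge chosen in `restrict` may jump from point to point; near `y` it can be replaced by the
fixed gauge `a`, which allows differentiation. -/
lemma restrict_eventuallyEq (hφ : IsSpinorField σM ρM φ) {b : B} {a : A} {y : F}
    (hb : y ∈ σF.dom b) (ha : S.incl y ∈ σM.dom a) :
    restrict Φ r φ b =ᶠ[𝓝 y] fun z => r.actLin (Φ.lift b a z : Cliff ε) (φ a (S.incl z)) := by
  filter_upwards [eventually_mem_dom hb ha] with z hz using restrict_eq Φ r hφ hz.1 hz.2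

lemma IsSpinorField.contMDiffAt (hφ : IsSpinorField σM ρM φ) {a : A} {x : M} (ha : x ∈ σM.dom a) :
    ContMDiffAt (𝓡 (n + 1)) 𝓘(ℝ, ΔM) ∞ (φ a) x :=
  (hφ.smooth a).contMDiffAt ((σM.isOpen_dom a).mem_nhds ha)

variable [FiniteDimensional ℂ ΔM] [FiniteDimensional ℂ ΔF]

lemma contMDiffAt_restrict (hφ : IsSpinorField σM ρM φ) {b : B} {y : F} (hb : y ∈ σF.dom b) :
    ContMDiffAt (𝓡 n) 𝓘(ℝ, ΔF) ∞ (restrict Φ r φ b) y := by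
  obtain ⟨a, ha⟩ := σM.exists_mem_dom (S.incl y)
  exact weaklySmoothAt_iff.1 (((weaklySmoothAt_lift Φ hb ha).bilinear
    ((weaklySmoothAt_iff.2 (hφ.contMDiffAt ha)).comp (S.smooth y)) r.actLin).congr
      (restrict_eventuallyEq Φ r hφ hb ha))

lemma isSpinorField_restrict (hφ : IsSpinorField σM ρM φ) :
    IsSpinorField σF ρF (restrict Φ r φ) where
  smooth b y hy := (contMDiffAt_restrict Φ r hφ hy).contMDiffWithinAt
  compat {b b' y} hb hb' := by
    obtain ⟨a, ha⟩ := σM.exists_mem_dom (S.incl y)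
    rw [restrict_eq Φ r hφ hb ha, restrict_eq Φ r hφ hb' ha, ← r.map_act, ← Module.End.mul_apply,
      ← map_mul, Φ.trans_lift hb hb' ha]

/-- The spinor derivative of the restriction of a spinor field to an umbilic hypersurface. -/
lemma spinorDeriv_restrict (hφ : IsSpinorField σM ρM φ) {b : B} {a : A} {y : F}
    (hb : y ∈ σF.dom b) (ha : S.incl y ∈ σM.dom a) {c : F → ℝ}
    {N : Π x : M, TangentSpace (𝓡 (n + 1)) x}
    (hN : MDifferentiableAt (𝓡 (n + 1)) (𝓡 (n + 1)).tangent
      (fun x => TotalSpace.mk' (EuclideanSpace ℝ (Fin (n + 1))) x (N x)) (S.incl y))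
    (hNS : ∀ᶠ z in 𝓝 y, N (S.incl z) = S.normal z)
    (hc : ∀ X : TangentSpace (𝓡 n) y,
      gM.leviCivita N (S.incl y) (mfderiv (𝓡 n) (𝓡 (n + 1)) S.incl y X)
        = c y • mfderiv (𝓡 n) (𝓡 (n + 1)) S.incl y X) (j : Fin n) :
    spinorDeriv σF ρF (restrict Φ r φ) b (σF.frame b j y)
      = r.toLin (ρM.act (Φ.lift b a y : Cliff ε)
          (spinorDeriv σM ρM φ a (mfderiv (𝓡 n) (𝓡 (n + 1)) S.incl y (σF.frame b j y))))
        + (1 / 2 * (((ε p : ℤ) : ℝ) * c y)) • r.toLin (ρM.act (basisVec ε (p.succAbove j))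
          (ρM.act (basisVec ε p * Φ.lift b a y) (φ a (S.incl y)))) := by
  obtain ⟨Du, Dc, hDu, hDc, hD⟩ := exists_hasWeakDeriv_lift Φ hb ha
  set v := σF.frame b j y with hv
  set w := mfderiv (𝓡 n) (𝓡 (n + 1)) S.incl y v with hw
  set u := Φ.lift b a y with hu
  obtain ⟨hD1, hD2, hD3⟩ := hD v
  obtain ⟨m, -, hm⟩ := exists_reverse_mul_self_of_mem_spin (Φ.lift_mem hb ha)
  have hskew := adaptedConnectionForm_skew hb ha hDc v
  -- The covariant derivative of the `k`-th adapted vector, written in both frames: its coordinates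
  -- in the adapted frame are the entries `ε_l Γ'_kl`.
  have hq : ∀ k, (u : Cliff ε) * vec ε (covDerivCoords S σM σF b a y Dc k v)
      = vec ε (fun l => ((ε l : ℤ) : ℝ) * adaptedConnectionForm S σM σF b a y Dc v k l) * u := by
    intro k
    have h1 := Φ.lift_frame hb ha
      (∑ i, covDerivCoords S σM σF b a y Dc k v i • σM.frame a i (S.incl y))
    rw [(σM.isOrthonormalFrame ha).coords_sum] at h1
    rw [h1]
    congr 2
    ext l
    rw [coords, (σM.isOrthonormalFrame ha).inner_eq, (σM.isOrthonormalFrame ha).coords_sum]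
    rfl
  have hgauge := gauge_change (σM.connectionForm_skew ha w) hskew u (Du v) _ (fun k => Dc k v)
    (involute_eq_self_of_mem_spin (Φ.lift_mem hb ha)) hD1 hm hD2
    (lift_mul_vec_adaptedCoords Φ hb ha) hD3 hq
  -- The tangential block is the connection form of `F`. Among the normal entries only `Γ'_pj = c
  -- ε_j` is nonzero, as `v` is the frame vector `s_j`, and `ε_j² = 1` removes its sign.
  have hbiv : bivector ε (adaptedConnectionForm S σM σF b a y Dc v)
      = CliffordAlgebra.map (hyperplane ε p) (bivector _ (σF.connectionForm b v))
        - (1 / 2 * (((ε p : ℤ) : ℝ) * c y)) • (basisVec ε (p.succAbove j) * basisVec ε p) := by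
    rw [bivector_eq_map_hyperplane_add (p := p) hskew]
    have h1 : (fun k l => adaptedConnectionForm S σM σF b a y Dc v (p.succAbove k) (p.succAbove l))
        = σF.connectionForm b v := by
      ext k l
      exact adaptedConnectionForm_tangential hb ha hDc j k l
    have h2 : ∀ l, adaptedConnectionForm S σM σF b a y Dc v p (p.succAbove l)
        = if j = l then c y * ((ε (p.succAbove j) : ℤ) : ℝ) else 0 := by
      intro l
      rw [adaptedConnectionForm_normal ha hDc hN hNS hc, adaptedFrame_succAbove, S.isometric,
        hv, σF.frame_orthonormal hb, mul_ite, mul_zero]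
    simp only [h1, h2, mul_ite, mul_zero, ite_smul, zero_smul, Finset.sum_ite_eq, Finset.mem_univ,
      if_true, smul_smul]
    congr 2
    linear_combination (1 / 2 * ((ε p : ℤ) : ℝ) * c y) * sign_mul_self (ε (p.succAbove j))
  -- The product rule for `u · φ_a` along `F`; `hgauge` then absorbs the term with `Du`.
  have hψ := ((hDu.bilinear ((hasWeakDeriv_mvfderiv ((hφ.contMDiffAt ha).mdifferentiableAt
    (by simp))).comp (S.mdifferentiableAt_incl y)) r.actLin).congr
      (restrict_eventuallyEq Φ r hφ hb ha)).unique (hasWeakDeriv_mvfderiv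
        ((contMDiffAt_restrict Φ r hφ hb).mdifferentiableAt (by simp)))
  rw [spinorDeriv_eq, spinorDeriv_eq, ← congrFun hψ v, restrict_eq Φ r hφ hb ha, ← r.map_act,
    eq_add_of_sub_eq hbiv.symm]
  have h3 := congrArg (fun x => r.toLin (ρM.act x (φ a (S.incl y)))) hgauge
  simp only [map_add, map_mul, map_smul, LinearMap.add_apply, Module.End.mul_apply,
    LinearMap.smul_apply, LinearMap.map_smul_of_tower] at h3 ⊢
  rw [← h3]
  simp only [SpinorIdentification.actLin, LinearMap.mk₂_apply]
  abel

end Restriction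

end SpinGeometry

end

theorem proposition4 {n : ℕ} {M F : Type*}
    [TopologicalSpace M] [T2Space M] [SecondCountableTopology M]
    [ChartedSpace (EuclideanSpace ℝ (Fin (n + 1))) M] [IsManifold (𝓡 (n + 1)) ∞ M]
    [TopologicalSpace F] [T2Space F] [SecondCountableTopology F]
    [ChartedSpace (EuclideanSpace ℝ (Fin n)) F] [IsManifold (𝓡 n) ∞ F]
    (gM : SemiRiemannianMetric (𝓡 (n + 1)) M) (gF : SemiRiemannianMetric (𝓡 n) F)
    (ε : Fin (n + 1) → ℤˣ) (p : Fin (n + 1))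
    (S : OrientedHypersurface gM gF (ε p)) (hS : IsUmbilic S)
    {A B : Type*} (σM : SpinStructure A gM ε)
    (σF : SpinStructure B gF (fun i => ε (p.succAbove i)))
    (Φ : InducedSpinStructure S σM σF)
    {ΔM ΔF : Type*} [NormedAddCommGroup ΔM] [NormedSpace ℂ ΔM] [FiniteDimensional ℂ ΔM]
    [NormedAddCommGroup ΔF] [NormedSpace ℂ ΔF] [FiniteDimensional ℂ ΔF]
    (ρM : SpinorModule ε ΔM) (ρF : SpinorModule (fun i => ε (p.succAbove i)) ΔF)
    (r : SpinorIdentification p ρM ρF)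
    (φ : A → M → ΔM) (hφ : IsTwistorSpinor σM ρM φ) :
    IsTwistorSpinor σF ρF (restrict Φ r φ) := by
  refine ⟨isSpinorField_restrict Φ r hφ.1, fun b y hb => ?_⟩
  obtain ⟨c, -, hS⟩ := hS
  obtain ⟨N, hN, hNS, hc⟩ := hS y
  obtain ⟨a, ha⟩ := σM.exists_mem_dom (S.incl y)
  -- The spinor `χ = -(1/(n+1)) (Dφ)|_F + (1/2) κ λ (η · φ)|_F`, with `e_p` standing for `η` in the
  -- adapted gauge. The coefficient involves the dimension of `M`, not of `F`.
  refine twistorOperator_eq_zero_of_spinorDeriv_eq hb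
    (-((1 / ((n + 1 : ℕ) : ℝ)) • r.toLin (ρM.act (Φ.lift b a y : Cliff ε)
        (dirac σM ρM φ a (S.incl y))))
      + (1 / 2 * (((ε p : ℤ) : ℝ) * c y)) • r.toLin
        (ρM.act (basisVec ε p * Φ.lift b a y) (φ a (S.incl y)))) fun j => ?_
  -- Passing to the adapted gauge turns multiplication by the pushed-forward `s_j` into
  -- multiplication by the basis vector `e_j` of the hyperplane.
  have hw : (Φ.lift b a y : Cliff ε) * vec ε (coords gM ε (fun i => σM.frame a i (S.incl y))
      (mfderiv (𝓡 n) (𝓡 (n + 1)) S.incl y (σF.frame b j y)))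
      = basisVec ε (p.succAbove j) * Φ.lift b a y := by
    rw [← lift_mul_vec_adaptedCoords Φ hb ha, adaptedCoords, adaptedFrame_succAbove]
  rw [spinorDeriv_restrict Φ r hφ.1 hb ha (hN.mdifferentiableAt (by simp)) hNS hc,
    spinorDeriv_eq_of_twistorOperator_eq_zero ha (hφ.2 a _ ha), cliffMul, map_neg,
    LinearMap.map_smul_of_tower, ← Module.End.mul_apply, ← map_mul, hw, map_mul,
    Module.End.mul_apply, ← map_hyperplane_basisVec, map_neg, LinearMap.map_smul_of_tower,
    r.map_act, r.map_act, map_add, map_neg, LinearMap.map_smul_of_tower,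
    LinearMap.map_smul_of_tower]
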